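/- Let $\gamma\in\mathbb R$ and consider the two-component system for $u=(u^1,u^2)$ \[ u^1_t=u^2_x,\qquad u^2_t=\left(\frac{(u^2)^2+\gamma u^2-1}{u^1}\right)_x , \] the metrics \[ g^{(3,1)}=\begin{pmatrix}-u^1&0\\0&\frac{(u^2)^2+\gamma u^2-1}{u^1}\end{pmatrix},\quad g^{(3,2)}=\begin{pmatrix}0&u^1\\u^1&2u^2+\gamma\end{pmatrix},\quad g^{(3,3)}=\begin{pmatrix}2u^2+\gamma&\frac{(u^2)^2+\gamma u^2-1}{u^1}\\\frac{(u^2)^2+\gamma u^2-1}{u^1}&0\end{pmatrix}, \] the local first-order homogeneous operators $P^{(3,a)}$, $a=1,2,3$, with entries $g^{ij}D_x+\Gamma^{ij}_ku^k_x$, where $g=g^{(3,a)}$ and $\Gamma^{ij}_k$ are the contravariant Christoffel symbols of the Levi-Civita connection of $g$ (that is, $g^{ij}_{,k}=\Gamma^{ij}_k+\Gamma^{ji}_k$ and $g^{is}\Gamma^{jk}_s=g^{js}\Gamma^{ik}_s$), and the third-order operator \[ R^{(3)}=D_x\begin{pmatrix} D_x & D_x\frac{u^2}{u^1} \\ \frac{u^2}{u^1}D_x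 & \frac{(u^2)^2+1}{2(u^1)^2}D_x+D_x\frac{(u^2)^2+1}{2(u^1)^2} \end{pmatrix}D_x . \] Let $U\subset\mathbb R^2$ be an open set of values of $(u^1,u^2)$ on which $u^1\neq0$. Then over $U$: (1) for each $a$ such that $\det g^{(3,a)}\ne0$ everywhere on $U$, the system is Hamiltonian with respect to $P^{(3,a)}$, i.e. $P^{(3,a)}$ is a Hamiltonian operator and the system has the form $u_t=P^{(3,a)}\,\delta H/\delta u$ for some local functional $H=\int h\,dx$; moreover $P^{(3,a)}$ is compatible with $R^{(3)}$; (2) $P^{(3,a)}$ and $P^{(3,b)}$ are compatible for all $a,b$ such that $\det g^{(3,a)}\ne0$ and $\det g^{(3,b)}\neq0$ everywhere on $U$. Here a matrix differential operator $A$ in $D_x$, whose coefficients are differential functions (smooth functions of $x$ and finitely many of the $x$-derivatives of $u$, with $u\in U$), is *Hamiltonian* if it is skew-adjoint and its Schouten bracket $[A,A]$ vanishes, where \[ [A_1,A_2](\psi^1,\psi^2,\psi^3)=\ell_{A_1,\psi^1}(A_2\psi^2)\,\psi^3+\ell_{A_2,\psi^1}(A_1\psi^2)\,\psi^3 +\text{cyclic}(\psi^1,\psi^2,\psi^3)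 \] is taken modulo total $x$-derivatives of differential functions, for arbitrary covectors $\psi^a$ whose components are differential functions, and $\ell_{A,\psi}(\varphi)^i=\sum\frac{\partial a^{it\sigma}}{\partial u^s_\tau}D_x^\sigma\psi_t\,D_x^\tau\varphi^s$ for $A^{ij}=\sum_\sigma a^{ij\sigma}D_x^\sigma$. Two operators $A,B$ are *compatible* if both are Hamiltonian and $A+\lambda B$ is Hamiltonian for every $\lambda\in\mathbb R$. -/

import Mathlib

open scoped ContDiff

noncomputable section

namespace HydroJet

/-- Points of the fibre of the infinite jet space: `J σ i` is the coordinate `u^i_σ`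
(the `σ`-th `x`-derivative of the field variable `u^i`), `J 0` is the field point `u`. -/
abbrev Jet (n : ℕ) : Type := ℕ → Fin n → ℝ

/-- Functions of `x` and of the jet coordinates. -/
abbrev JetFun (n : ℕ) : Type := ℝ → Jet n → ℝ

/-- `F` is a differential function over the open set `U` of field values: over `U` it is a
smooth function of `x` and of finitely many jet coordinates. -/
def IsDiffFun {n : ℕ} (U : Set (Fin n → ℝ)) (F : JetFun n) : Prop :=
  ∃ (N : ℕ) (f : ℝ × (Fin (N + 1) → Fin n → ℝ) → ℝ),
    ContDiffOn ℝ ∞ f {p | p.2 0 ∈ U} ∧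
    ∀ (x : ℝ) (J : Jet n), J 0 ∈ U → F x J = f (x, fun k => J k)

/-- The partial derivative `∂F/∂u^i_σ`. -/
def jetPartial {n : ℕ} (σ : ℕ) (i : Fin n) (F : JetFun n) : JetFun n := fun x J =>
  deriv (fun s : ℝ => F x (Function.update J σ (Function.update (J σ) i s))) (J σ i)

/-- The total derivative `D_x F = ∂F/∂x + ∑_{σ,i} u^i_{σ+1} ∂F/∂u^i_σ`; the sum over `σ` is
finite for a differential function. -/
def totalD {n : ℕ} (F : JetFun n) : JetFun n := fun x J =>
  deriv (fun s : ℝ => F s J) x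
    + ∑ᶠ σ : ℕ, ∑ i : Fin n, J (σ + 1) i * jetPartial σ i F x J

/-- `F` is a total divergence over `U`, i.e. it vanishes modulo the image of `D_x`. -/
def IsTotalDiv {n : ℕ} (U : Set (Fin n → ℝ)) (F : JetFun n) : Prop :=
  ∃ Q : JetFun n, IsDiffFun U Q ∧ ∀ (x : ℝ) (J : Jet n), J 0 ∈ U → F x J = totalD Q x J

/-- The variational derivative `δh/δu^i = ∑_σ (-D_x)^σ (∂h/∂u^i_σ)`. -/
def varDeriv {n : ℕ} (h : JetFun n) (i : Fin n) : JetFun n := fun x J =>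
  ∑ᶠ σ : ℕ, (-1 : ℝ) ^ σ * (totalD^[σ] (jetPartial σ i h)) x J

/-- A function of the field variables alone, seen as a function on the jet space. -/
def ofField {n : ℕ} (f : (Fin n → ℝ) → ℝ) : JetFun n := fun _ J => f (J 0)

/-- Scalar differential operators `∑_σ a_σ D_x^σ`, given by their coefficients. -/
abbrev DiffOp (n : ℕ) : Type := ℕ →₀ JetFun n

/-- The operator `D_x`. -/
def opD {n : ℕ} : DiffOp n := Finsupp.single 1 1

/-- The operator of multiplication by `f`. -/
def opMul {n : ℕ} (f : JetFun n) : DiffOp n := Finsupp.single 0 f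

/-- Composition of scalar differential operators, by the Leibniz rule
`(a D^σ) ∘ (b D^τ) = ∑_k (σ choose k) a (D^k b) D^{σ-k+τ}`. -/
def opComp {n : ℕ} (A B : DiffOp n) : DiffOp n :=
  A.sum fun σ a => B.sum fun τ b =>
    ∑ k ∈ Finset.range (σ + 1),
      Finsupp.single (σ - k + τ) (fun x J => (σ.choose k : ℝ) * a x J * (totalD^[k] b) x J)

/-- Matrix differential operators `A^{ij} = ∑_σ a^{ijσ} D_x^σ`. -/
abbrev MatDiffOp (n : ℕ) : Type := Fin n → Fin n → DiffOp n

/-- `A(ψ)^i = ∑_{j,σ} a^{ijσ} D_x^σ ψ_j`. -/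
def MatDiffOp.apply {n : ℕ} (A : MatDiffOp n) (ψ : Fin n → JetFun n) : Fin n → JetFun n :=
  fun i x J => ∑ j : Fin n, (A i j).sum fun σ a => a x J * (totalD^[σ] (ψ j)) x J

/-- The linearization
`ℓ_{A,ψ}(φ)^i = ∑ (∂a^{itσ}/∂u^s_τ) (D_x^σ ψ_t) (D_x^τ φ^s)`. -/
def MatDiffOp.linearize {n : ℕ} (A : MatDiffOp n) (ψ φ : Fin n → JetFun n) :
    Fin n → JetFun n :=
  fun i x J => ∑ t : Fin n, (A i t).sum fun σ a =>
    ∑ᶠ τ : ℕ, ∑ s : Fin n,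
      jetPartial τ s a x J * (totalD^[σ] (ψ t)) x J * (totalD^[τ] (φ s)) x J

/-- The pairing of a covector with a vector (a density, to be taken modulo total divergences). -/
def pairing {n : ℕ} (ψ φ : Fin n → JetFun n) : JetFun n := fun x J =>
  ∑ i : Fin n, ψ i x J * φ i x J

/-- The density of the Schouten bracket `[A₁,A₂](ψ¹,ψ²,ψ³)`:
the sum over cyclic permutations of
`ℓ_{A₁,ψ¹}(A₂(ψ²)) ψ³ + ℓ_{A₂,ψ¹}(A₁(ψ²)) ψ³`. -/
def schouten {n : ℕ} (A₁ A₂ : MatDiffOp n) (ψ₁ ψ₂ ψ₃ : Fin n → JetFun n) : JetFun n :=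
  pairing ψ₃ (A₁.linearize ψ₁ (A₂.apply ψ₂))
    + pairing ψ₁ (A₁.linearize ψ₂ (A₂.apply ψ₃))
    + pairing ψ₂ (A₁.linearize ψ₃ (A₂.apply ψ₁))
    + pairing ψ₃ (A₂.linearize ψ₁ (A₁.apply ψ₂))
    + pairing ψ₁ (A₂.linearize ψ₂ (A₁.apply ψ₃))
    + pairing ψ₂ (A₂.linearize ψ₃ (A₁.apply ψ₁))

/-- `A` is a Hamiltonian operator over `U`: its coefficients are differential functions, it is
skew-adjoint, and its Schouten bracket `[A,A]` vanishes, i.e. is a total divergence on all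
covectors. -/
structure IsHamiltonian {n : ℕ} (U : Set (Fin n → ℝ)) (A : MatDiffOp n) : Prop where
  coeff : ∀ i j σ, IsDiffFun U (A i j σ)
  skew : ∀ ψ φ : Fin n → JetFun n, (∀ i, IsDiffFun U (ψ i)) → (∀ i, IsDiffFun U (φ i)) →
    IsTotalDiv U (pairing ψ (A.apply φ) + pairing φ (A.apply ψ))
  jacobi : ∀ ψ₁ ψ₂ ψ₃ : Fin n → JetFun n, (∀ i, IsDiffFun U (ψ₁ i)) →
    (∀ i, IsDiffFun U (ψ₂ i)) → (∀ i, IsDiffFun U (ψ₃ i)) →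
    IsTotalDiv U (schouten A A ψ₁ ψ₂ ψ₃)

/-- `A` and `B` are compatible Hamiltonian operators over `U`: both are Hamiltonian, and so is
`A + lam B` for every real `lam`. -/
def Compatible {n : ℕ} (U : Set (Fin n → ℝ)) (A B : MatDiffOp n) : Prop :=
  IsHamiltonian U A ∧ IsHamiltonian U B ∧ ∀ lam : ℝ, IsHamiltonian U (A + lam • B)

/-- The evolutionary system `u^i_t = F^i` is Hamiltonian over `U` with respect to `A`: the
operator `A` is Hamiltonian and `F = A(δH/δu)` for some local functional `H = ∫ h dx`. -/
def IsHamiltonianSystem {n : ℕ} (U : Set (Fin n → ℝ)) (F : Fin n → JetFun n)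
    (A : MatDiffOp n) : Prop :=
  IsHamiltonian U A ∧ ∃ h : JetFun n, IsDiffFun U h ∧
    ∀ (i : Fin n) (x : ℝ) (J : Jet n), J 0 ∈ U → F i x J = A.apply (varDeriv h) i x J

/-- The right-hand side of the conservative system `u^i_t = (V^i(u))_x`. -/
def conservative {n : ℕ} (V : Fin n → (Fin n → ℝ) → ℝ) : Fin n → JetFun n :=
  fun i => totalD (ofField (V i))

/-- The partial derivative `∂f/∂u^k` of a function of the field variables. -/
def fieldPartial {n : ℕ} (k : Fin n) (f : (Fin n → ℝ) → ℝ) : (Fin n → ℝ) → ℝ := fun u =>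
  deriv (fun s : ℝ => f (Function.update u k s)) (u k)

/-- The contravariant Christoffel symbols `Γ^{ij}_k = -g^{ih} Γ^j_{hk}` of the Levi-Civita
connection of a nondegenerate contravariant metric `g^{ij}`. They are the solution of
`g^{ij}_{,k} = Γ^{ij}_k + Γ^{ji}_k`, `g^{is} Γ^{jk}_s = g^{js} Γ^{ik}_s`, namely
`g^{ls} Γ^{ij}_s = (g^{is} g^{jl}_{,s} + g^{ls} g^{ij}_{,s} - g^{js} g^{il}_{,s}) / 2`. -/
def christoffel {n : ℕ} (g : (Fin n → ℝ) → Matrix (Fin n) (Fin n) ℝ) (i j k : Fin n) :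
    (Fin n → ℝ) → ℝ := fun u =>
  ∑ l : Fin n, (g u)⁻¹ k l * ((1 / 2) * ∑ s : Fin n,
    (g u i s * fieldPartial s (fun w => g w j l) u
      + g u l s * fieldPartial s (fun w => g w i j) u
      - g u j s * fieldPartial s (fun w => g w i l) u))

/-- The local first-order homogeneous (Dubrovin--Novikov) operator
`P^{ij} = g^{ij} D_x + Γ^{ij}_k u^k_x` parameterised by the metric `g^{ij}`. -/
def firstOrderOp {n : ℕ} (g : (Fin n → ℝ) → Matrix (Fin n) (Fin n) ℝ) : MatDiffOp n :=
  fun i j =>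
    opComp (opMul (ofField fun u => g u i j)) opD
      + opMul (fun _ J => ∑ k : Fin n, christoffel g i j k (J 0) * J 1 k)

/-- The metric `g` is nondegenerate at every point of `U`. -/
def Nondegenerate {n : ℕ} (U : Set (Fin n → ℝ))
    (g : (Fin n → ℝ) → Matrix (Fin n) (Fin n) ℝ) : Prop :=
  ∀ u ∈ U, (g u).det ≠ 0

/-! Below `u 0` and `u 1` are the field variables `u^1` and `u^2`. -/

/-- The fluxes of the system
`u^1_t = (u^2)_x`, `u^2_t = (((u^2)^2 + γ u^2 - 1) / u^1)_x`. -/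
def flux (γ : ℝ) : Fin 2 → (Fin 2 → ℝ) → ℝ :=
  ![fun u => u 1, fun u => (u 1 ^ 2 + γ * u 1 - 1) / u 0]

/-- The three metrics. -/
def metric (γ : ℝ) : Fin 3 → (Fin 2 → ℝ) → Matrix (Fin 2) (Fin 2) ℝ :=
  ![fun u => !![-u 0, 0; 0, (u 1 ^ 2 + γ * u 1 - 1) / u 0],
    fun u => !![0, u 0; u 0, 2 * u 1 + γ],
    fun u => !![2 * u 1 + γ, (u 1 ^ 2 + γ * u 1 - 1) / u 0;
                (u 1 ^ 2 + γ * u 1 - 1) / u 0, 0]]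

/-- The matrix operator between the two outer factors `D_x` of the third-order operator. -/
def innerOp : MatDiffOp 2 :=
  let a : DiffOp 2 := opMul (ofField fun u => u 1 / u 0)
  let b : DiffOp 2 := opMul (ofField fun u => (u 1 ^ 2 + 1) / (2 * u 0 ^ 2))
  ![![opD, opComp opD a],
    ![opComp a opD, opComp b opD + opComp opD b]]

/-- The third-order operator
`D_x (D_x, D_x (u^2/u^1); (u^2/u^1) D_x, b D_x + D_x b) D_x`, `b = ((u^2)^2 + 1) / (2 (u^1)^2)`. -/
def thirdOrderOp : MatDiffOp 2 :=
  fun i j => opComp opD (opComp (innerOp i j) opD)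

end HydroJet

end

/-! The theorem reduces to identities in a commutative real algebra with one derivation.
Differential functions over `U` form such an algebra, with the total derivative `D`. For a
characteristic φ there is the evolutionary derivation `ev φ`, which commutes with `D` (`ev_D`), and
ℓ_{A,ψ}(φ) is obtained by applying `ev φ` to the coefficients of A. So composed operators can be
linearized by the Leibniz rule, with no expansion of coefficients.

Two structural facts make the operators tractable. Each metric has Christoffel symbols that are
gradients: there are potentials b with g = b + bᵀ and Γ^{ij}_k = ∂_k b^{ij} (`metric_eq`,
`christoffel_metric`), so P = bᵀD + D b, and b is linear in the constants of the pencil. With a =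
u²/u¹ and ι = 1/u¹, the third-order operator factors as R = D W D Wᵀ D for W with rows (1, 0) and
(a, ι) (`matSem_thirdOrderOp`). Skew-adjointness is visible from these forms.

For the Jacobi identity, integration by parts removes all derivatives from φ: modulo total
derivatives, z · ℓ_{A,x}(φ) is ∑ φ^s E_s(x,z), with E = `pE` for P and E = `rE` for R
(`pairing_linearization`). Taking φ = T y with T = P + λR and summing cyclically gives three parts.
The PP part vanishes identically (`cyclic_pE`), the PR part vanishes after the outer D of R is moved
onto `pE` (`cyclic_pE_rE`), and the RR part is an explicit total derivative (`cyclic_rE`). As the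
potentials contain arbitrary constants c and λ is arbitrary, this yields every Hamiltonian and
compatibility claim at once.

The system itself is obtained from the densities 2u², ((u²+γ/2)² + 1 + γ²/4)/(2u¹) and u¹ for the
three metrics respectively. -/

noncomputable section

namespace HydroJet

open TopologicalSpace

/-! ### The differential algebra of functions on the jet space -/

section DifferentialAlgebra

variable {n : ℕ}

/-- The first `N + 1` jet coordinates. -/
def trunc (N : ℕ) (J : Jet n) : Fin (N + 1) → Fin n → ℝ := fun k => J k

/-- `f` represents `F` over `U` as a smooth function of `x` and of the jet coordinates of
order at most `N`. -/
def JetRep (U : Set (Fin n → ℝ)) (N : ℕ) (f : ℝ × (Fin (N + 1) → Fin n → ℝ) → ℝ)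
    (F : JetFun n) : Prop :=
  ContDiffOn ℝ ∞ f {p | p.2 0 ∈ U} ∧
    ∀ (x : ℝ) (J : Jet n), J 0 ∈ U → F x J = f (x, trunc N J)

theorem JetRep.exists_of_le {U : Set (Fin n → ℝ)} {N M : ℕ}
    {f : ℝ × (Fin (N + 1) → Fin n → ℝ) → ℝ} {F : JetFun n} (h : JetRep U N f F) (hNM : N ≤ M) :
    ∃ f', JetRep U M f' F := by
  let r : ℝ × (Fin (M + 1) → Fin n → ℝ) → ℝ × (Fin (N + 1) → Fin n → ℝ) :=
    fun p => (p.1, fun k => p.2 (Fin.castLE (by omega) k))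
  have hr : ContDiff ℝ ∞ r := by
    refine contDiff_fst.prodMk (contDiff_pi.2 fun k => ?_)
    exact (contDiff_apply ℝ (Fin n → ℝ) (Fin.castLE (by omega : N + 1 ≤ M + 1) k)).comp
      contDiff_snd
  exact ⟨f ∘ r, h.1.comp hr.contDiffOn fun p hp => hp, fun x J hJ => h.2 x J hJ⟩

theorem isOpen_jetDomain {U : Set (Fin n → ℝ)} (hU : IsOpen U) (N : ℕ) :
    IsOpen {p : ℝ × (Fin (N + 1) → Fin n → ℝ) | p.2 0 ∈ U} :=
  hU.preimage ((continuous_apply 0).comp continuous_snd)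

/-- The derivative of a function on the jet space in the constant direction `c`. -/
def lineD (c : ℝ × Jet n) (F : JetFun n) : JetFun n := fun x J =>
  deriv (fun s : ℝ => F (x + s * c.1) (J + s • c.2)) 0

theorem JetRep.hasDerivAt {U : Set (Fin n → ℝ)} (hU : IsOpen U) {N : ℕ}
    {f : ℝ × (Fin (N + 1) → Fin n → ℝ) → ℝ} {F : JetFun n} (h : JetRep U N f F)
    (c : ℝ × Jet n) (x : ℝ) {J : Jet n} (hJ : J 0 ∈ U) :
    HasDerivAt (fun s : ℝ => F (x + s * c.1) (J + s • c.2))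
      (fderiv ℝ f (x, trunc N J) (c.1, trunc N c.2)) 0 := by
  have hf : DifferentiableAt ℝ f (x, trunc N J) :=
    (h.1.contDiffAt ((isOpen_jetDomain hU N).mem_nhds hJ)).differentiableAt (by simp)
  have hl : HasDerivAt (fun s : ℝ => (x + s * c.1, trunc N J + s • trunc N c.2))
      (c.1, trunc N c.2) 0 := by
    refine HasDerivAt.prodMk ?_ ?_
    · simpa using ((hasDerivAt_id (0 : ℝ)).mul_const c.1).const_add x
    · simpa using ((hasDerivAt_id (0 : ℝ)).smul_const (trunc N c.2)).const_add (trunc N J)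
  have hf' : HasFDerivAt f (fderiv ℝ f (x, trunc N J))
      ((fun s : ℝ => (x + s * c.1, trunc N J + s • trunc N c.2)) 0) := by
    simpa using hf.hasFDerivAt
  refine (hf'.comp_hasDerivAt 0 hl).congr_of_eventuallyEq ?_
  -- As `U` is open, the line stays over `U` for small s, so values of `F` off `U` do not affect the
  -- derivative.
  have hc : Continuous fun s : ℝ => J 0 + s • c.2 0 := by fun_prop
  have : ∀ᶠ s : ℝ in nhds 0, J 0 + s • c.2 0 ∈ U :=
    hc.continuousAt.eventually_mem (hU.mem_nhds (by simpa using hJ))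
  filter_upwards [this] with s hs
  exact h.2 _ _ hs

theorem JetRep.lineD_eq {U : Set (Fin n → ℝ)} (hU : IsOpen U) {N : ℕ}
    {f : ℝ × (Fin (N + 1) → Fin n → ℝ) → ℝ} {F : JetFun n} (h : JetRep U N f F)
    (c : ℝ × Jet n) (x : ℝ) {J : Jet n} (hJ : J 0 ∈ U) :
    lineD c F x J = fderiv ℝ f (x, trunc N J) (c.1, trunc N c.2) :=
  (h.hasDerivAt hU c x hJ).deriv

theorem JetRep.lineD {U : Set (Fin n → ℝ)} (hU : IsOpen U) {N : ℕ}
    {f : ℝ × (Fin (N + 1) → Fin n → ℝ) → ℝ} {F : JetFun n} (h : JetRep U N f F)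
    (c : ℝ × Jet n) :
    JetRep U N (fun p => fderiv ℝ f p (c.1, trunc N c.2)) (lineD c F) := by
  refine ⟨?_, fun x J hJ => h.lineD_eq hU c x hJ⟩
  exact (h.1.fderiv_of_isOpen (isOpen_jetDomain hU N) (by simp)).clm_apply contDiffOn_const

/-- Symmetry of the second derivative of a smooth representative. Both ∂/∂x and every ∂/∂u^i_σ are
derivatives in constant directions, so this one statement covers all their commutators. -/
theorem lineD_comm {U : Set (Fin n → ℝ)} (hU : IsOpen U) {F : JetFun n} (h : IsDiffFun U F)
    (c d : ℝ × Jet n) (x : ℝ) {J : Jet n} (hJ : J 0 ∈ U) :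
    lineD c (lineD d F) x J = lineD d (lineD c F) x J := by
  obtain ⟨N, f, hf⟩ := h
  have hf : JetRep U N f F := hf
  have hat : ContDiffAt ℝ ∞ f (x, trunc N J) :=
    hf.1.contDiffAt ((isOpen_jetDomain hU N).mem_nhds hJ)
  have hd : DifferentiableAt ℝ (fderiv ℝ f) (x, trunc N J) :=
    (hat.fderiv_right (m := ∞) (by simp)).differentiableAt (by simp)
  rw [(hf.lineD hU d).lineD_eq hU c x hJ, (hf.lineD hU c).lineD_eq hU d x hJ]
  rw [fderiv_clm_apply hd (by fun_prop), fderiv_clm_apply hd (by fun_prop)]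
  simpa using hat.isSymmSndFDerivAt (by simpa using ENat.LEInfty.out) (c.1, trunc N c.2)
    (d.1, trunc N d.2)

theorem lineD_congr {U : Set (Fin n → ℝ)} (hU : IsOpen U) {F G : JetFun n}
    (h : ∀ x (J : Jet n), J 0 ∈ U → F x J = G x J) (c : ℝ × Jet n) (x : ℝ) {J : Jet n}
    (hJ : J 0 ∈ U) : lineD c F x J = lineD c G x J := by
  refine Filter.EventuallyEq.deriv_eq ?_
  have hc : Continuous fun s : ℝ => J 0 + s • c.2 0 := by fun_prop
  have : ∀ᶠ s : ℝ in nhds 0, J 0 + s • c.2 0 ∈ U :=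
    hc.continuousAt.eventually_mem (hU.mem_nhds (by simpa using hJ))
  filter_upwards [this] with s hs
  exact h _ _ hs

/-- The direction of the jet coordinate `u^i_σ`. -/
def dirJ (σ : ℕ) (i : Fin n) : ℝ × Jet n := (0, Pi.single σ (Pi.single i 1))

theorem jetPartial_eq_lineD (σ : ℕ) (i : Fin n) (F : JetFun n) :
    jetPartial σ i F = lineD (dirJ σ i) F := by
  funext x J
  have h := deriv_comp_const_add (f := fun s : ℝ =>
    F x (Function.update J σ (Function.update (J σ) i s))) (J σ i) 0
  rw [add_zero] at h
  rw [jetPartial, ← h, lineD]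
  congr 1
  funext s
  congr 1
  · simp [dirJ]
  · funext k j
    by_cases hk : k = σ
    · subst hk
      by_cases hj : j = i
      · subst hj; simp [dirJ]
      · simp [dirJ, hj]
    · simp [dirJ, hk]

theorem totalD_eq_lineD (F : JetFun n) :
    totalD F = fun x J => lineD (1, 0) F x J
      + ∑ᶠ σ : ℕ, ∑ i : Fin n, J (σ + 1) i * lineD (dirJ σ i) F x J := by
  funext x J
  simp only [totalD, jetPartial_eq_lineD]
  congr 1
  have h := deriv_comp_const_add (f := fun s : ℝ => F s J) x 0
  rw [add_zero] at h
  rw [← h, lineD]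
  simp

/-- The domain of the differential functions over `U`. -/
abbrev JetDom (U : Opens (Fin n → ℝ)) : Type := {p : ℝ × Jet n // p.2 0 ∈ U}

/-- The algebra of differential functions over `U`. -/
def diffSubalgebra (U : Opens (Fin n → ℝ)) : Subalgebra ℝ (JetDom U → ℝ) where
  carrier := {a | ∃ F : JetFun n, IsDiffFun (U : Set (Fin n → ℝ)) F ∧
    ∀ p : JetDom U, F p.1.1 p.1.2 = a p}
  mul_mem' := by
    rintro a b ⟨F, ⟨N, f, hf⟩, hF⟩ ⟨G, ⟨M, g, hg⟩, hG⟩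
    obtain ⟨f', hf'⟩ := JetRep.exists_of_le (h := hf) (le_max_left N M)
    obtain ⟨g', hg'⟩ := JetRep.exists_of_le (h := hg) (le_max_right N M)
    refine ⟨fun x J => F x J * G x J, ⟨_, fun p => f' p * g' p, hf'.1.mul hg'.1, ?_⟩, ?_⟩
    · intro x J hJ
      exact congrArg₂ _ (hf'.2 x J hJ) (hg'.2 x J hJ)
    · intro p
      exact congrArg₂ _ (hF p) (hG p)
  add_mem' := by
    rintro a b ⟨F, ⟨N, f, hf⟩, hF⟩ ⟨G, ⟨M, g, hg⟩, hG⟩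
    obtain ⟨f', hf'⟩ := JetRep.exists_of_le (h := hf) (le_max_left N M)
    obtain ⟨g', hg'⟩ := JetRep.exists_of_le (h := hg) (le_max_right N M)
    refine ⟨fun x J => F x J + G x J, ⟨_, fun p => f' p + g' p, hf'.1.add hg'.1, ?_⟩, ?_⟩
    · intro x J hJ
      exact congrArg₂ _ (hf'.2 x J hJ) (hg'.2 x J hJ)
    · intro p
      exact congrArg₂ _ (hF p) (hG p)
  algebraMap_mem' r :=
    ⟨fun _ _ => r, ⟨0, fun _ => r, contDiffOn_const, fun _ _ _ => rfl⟩, fun _ => rfl⟩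

/-- The type of differential functions over `U`. -/
def DiffAlg (U : Opens (Fin n → ℝ)) : Type := diffSubalgebra U

instance (U : Opens (Fin n → ℝ)) : CommRing (DiffAlg U) :=
  inferInstanceAs (CommRing (diffSubalgebra U))

instance (U : Opens (Fin n → ℝ)) : Algebra ℝ (DiffAlg U) :=
  inferInstanceAs (Algebra ℝ (diffSubalgebra U))

variable {U : Opens (Fin n → ℝ)}

@[ext]
theorem DiffAlg.ext {a b : DiffAlg U} (h : ∀ p, a.1 p = b.1 p) : a = b :=
  Subtype.ext (funext h)

/-- The function `F` on the jet space represents the differential function `a`. -/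
def Repr (F : JetFun n) (a : DiffAlg U) : Prop :=
  ∀ x (J : Jet n) (h : J 0 ∈ U), F x J = a.1 ⟨(x, J), h⟩

open Classical in
/-- The extension of a differential function by zero. -/
def ext0 (a : DiffAlg U) : JetFun n := fun x J =>
  if h : J 0 ∈ U then a.1 ⟨(x, J), h⟩ else 0

theorem repr_ext0 (a : DiffAlg U) : Repr (ext0 a) a := fun x J h => by simp [ext0, h]

theorem IsDiffFun.congr {V : Set (Fin n → ℝ)} {F G : JetFun n} (h : IsDiffFun V F)
    (hFG : ∀ x (J : Jet n), J 0 ∈ V → G x J = F x J) : IsDiffFun V G := by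
  obtain ⟨N, f, hf, hF⟩ := h
  exact ⟨N, f, hf, fun x J hJ => (hFG x J hJ).trans (hF x J hJ)⟩

theorem Repr.isDiffFun {F : JetFun n} {a : DiffAlg U} (h : Repr F a) :
    IsDiffFun (U : Set (Fin n → ℝ)) F := by
  obtain ⟨G, hG, hGa⟩ := a.2
  exact hG.congr fun x J hJ => (h x J hJ).trans (hGa ⟨(x, J), hJ⟩).symm

theorem exists_repr {F : JetFun n} (h : IsDiffFun (U : Set (Fin n → ℝ)) F) :
    ∃ a : DiffAlg U, Repr F a :=
  ⟨⟨fun p => F p.1.1 p.1.2, F, h, fun _ => rfl⟩, fun _ _ _ => rfl⟩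

theorem Repr.eq {F : JetFun n} {a b : DiffAlg U} (ha : Repr F a) (hb : Repr F b) : a = b := by
  ext ⟨⟨x, J⟩, h⟩
  exact (ha x J h).symm.trans (hb x J h)

theorem Repr.add {F G : JetFun n} {a b : DiffAlg U} (ha : Repr F a) (hb : Repr G b) :
    Repr (fun x J => F x J + G x J) (a + b) := fun x J h =>
  congrArg₂ _ (ha x J h) (hb x J h)

theorem Repr.mul {F G : JetFun n} {a b : DiffAlg U} (ha : Repr F a) (hb : Repr G b) :
    Repr (fun x J => F x J * G x J) (a * b) := fun x J h =>
  congrArg₂ _ (ha x J h) (hb x J h)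

theorem repr_const (r : ℝ) : Repr (fun _ _ => r) (algebraMap ℝ (DiffAlg U) r) :=
  fun _ _ _ => rfl

theorem repr_zero : Repr (fun _ _ => 0) (0 : DiffAlg U) := fun _ _ _ => rfl

theorem repr_one : Repr (fun _ _ => 1) (1 : DiffAlg U) := fun _ _ _ => rfl

theorem Repr.sum {ι : Type*} (s : Finset ι) {F : ι → JetFun n} {a : ι → DiffAlg U}
    (h : ∀ i ∈ s, Repr (F i) (a i)) : Repr (fun x J => ∑ i ∈ s, F i x J) (∑ i ∈ s, a i) := by
  classical
  induction s using Finset.induction_on with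
  | empty => simpa using repr_zero
  | insert i s hi ih =>
    simp only [Finset.sum_insert hi]
    exact (h i (by simp)).add (ih fun j hj => h j (by simp [hj]))

theorem hasDerivAt_lineD {F : JetFun n} (h : IsDiffFun (U : Set (Fin n → ℝ)) F) (c : ℝ × Jet n)
    (x : ℝ) {J : Jet n} (hJ : J 0 ∈ U) :
    HasDerivAt (fun s : ℝ => F (x + s * c.1) (J + s • c.2)) (lineD c F x J) 0 := by
  obtain ⟨N, f, hf⟩ := h
  have hf : JetRep _ N f F := hf
  rw [hf.lineD_eq U.2 c x hJ]
  exact hf.hasDerivAt U.2 c x hJ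

theorem isDiffFun_lineD {F : JetFun n} (h : IsDiffFun (U : Set (Fin n → ℝ)) F)
    (c : ℝ × Jet n) : IsDiffFun (U : Set (Fin n → ℝ)) (lineD c F) := by
  obtain ⟨N, f, hf⟩ := h
  exact ⟨N, _, JetRep.lineD U.2 hf c⟩

/-- The derivation of the algebra of differential functions in a constant direction. -/
def dirD (c : ℝ × Jet n) : Derivation ℝ (DiffAlg U) (DiffAlg U) := by
  refine Derivation.mk' (⟨⟨fun a => ⟨fun p => lineD c (ext0 a) p.1.1 p.1.2, _,
    isDiffFun_lineD (repr_ext0 a).isDiffFun c, fun p => rfl⟩, ?_⟩, ?_⟩) ?_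
  · intro a b
    ext ⟨⟨x, J⟩, h⟩
    refine (lineD_congr U.2 (G := fun x J => ext0 a x J + ext0 b x J) ?_ c x h).trans ?_
    · intro x J hJ
      exact (repr_ext0 (a + b) x J hJ).trans (((repr_ext0 a).add (repr_ext0 b)) x J hJ).symm
    · exact ((hasDerivAt_lineD (repr_ext0 a).isDiffFun c x h).add
        (hasDerivAt_lineD (repr_ext0 b).isDiffFun c x h)).deriv
  · intro r a
    ext ⟨⟨x, J⟩, h⟩
    refine (lineD_congr U.2 (G := fun x J => r * ext0 a x J) ?_ c x h).trans ?_
    · intro x J hJ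
      rw [repr_ext0 (r • a) x J hJ, repr_ext0 a x J hJ]
      rfl
    · exact ((hasDerivAt_lineD (repr_ext0 a).isDiffFun c x h).const_mul r).deriv
  · intro a b
    ext ⟨⟨x, J⟩, h⟩
    refine (lineD_congr U.2 (G := fun x J => ext0 a x J * ext0 b x J) ?_ c x h).trans ?_
    · intro x J hJ
      exact (repr_ext0 (a * b) x J hJ).trans (((repr_ext0 a).mul (repr_ext0 b)) x J hJ).symm
    · refine ((hasDerivAt_lineD (repr_ext0 a).isDiffFun c x h).mul
        (hasDerivAt_lineD (repr_ext0 b).isDiffFun c x h)).deriv.trans ?_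
      simp only [zero_mul, add_zero, zero_smul]
      rw [repr_ext0 a x J h, repr_ext0 b x J h]
      change _ = a.1 ⟨(x, J), h⟩ * lineD c (ext0 b) x J + b.1 ⟨(x, J), h⟩ * lineD c (ext0 a) x J
      ring

theorem Repr.lineD {F : JetFun n} {a : DiffAlg U} (h : Repr F a) (c : ℝ × Jet n) :
    Repr (lineD c F) (dirD c a) := fun x _ hJ =>
  lineD_congr U.2 (fun x J hJ => (h x J hJ).trans (repr_ext0 a x J hJ).symm) c x hJ

theorem dirD_comm (c d : ℝ × Jet n) (a : DiffAlg U) : dirD c (dirD d a) = dirD d (dirD c a) := by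
  have h := repr_ext0 a
  ext ⟨⟨x, J⟩, hJ⟩
  rw [← ((h.lineD d).lineD c) x J hJ, ← ((h.lineD c).lineD d) x J hJ]
  exact lineD_comm U.2 h.isDiffFun c d x hJ

/-- The jet coordinate `u^i_σ`. -/
def coord (U : Opens (Fin n → ℝ)) (σ : ℕ) (i : Fin n) : DiffAlg U :=
  ⟨fun p => p.1.2 σ i, fun _ J => J σ i, ⟨σ, fun p => p.2 (Fin.last σ) i,
    ((contDiff_apply_apply ℝ ℝ (Fin.last σ) i).comp contDiff_snd).contDiffOn,
    fun _ _ _ => rfl⟩, fun _ => rfl⟩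

theorem repr_coord (σ : ℕ) (i : Fin n) : Repr (fun _ J => J σ i) (coord U σ i) :=
  fun _ _ _ => rfl

theorem dirD_coord (c : ℝ × Jet n) (σ : ℕ) (i : Fin n) :
    dirD c (coord U σ i) = algebraMap ℝ (DiffAlg U) (c.2 σ i) := by
  refine ((repr_coord σ i).lineD c).eq fun x J h => ?_
  change deriv (fun s : ℝ => (J + s • c.2) σ i) 0 = c.2 σ i
  simp

/-- The partial derivative `∂/∂u^i_σ` on differential functions. -/
abbrev pd (σ : ℕ) (i : Fin n) : Derivation ℝ (DiffAlg U) (DiffAlg U) := dirD (dirJ σ i)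

theorem exists_pd_eq_zero (a : DiffAlg U) : ∃ N, ∀ σ, N < σ → ∀ i, pd σ i a = 0 := by
  obtain ⟨N, f, hf⟩ := (repr_ext0 a).isDiffFun
  have hf : JetRep _ N f (ext0 a) := hf
  refine ⟨N, fun σ hσ i => ?_⟩
  ext ⟨⟨x, J⟩, h⟩
  rw [← (repr_ext0 a).lineD _ x J h, hf.lineD_eq U.2 _ x h]
  have : trunc N (dirJ σ i).2 = 0 := by
    funext k j
    have : (k : ℕ) ≠ σ := by omega
    simp [trunc, dirJ, this]
  rw [this]
  exact map_zero _

theorem Repr.jetPartial {F : JetFun n} {a : DiffAlg U} (h : Repr F a) (σ : ℕ) (i : Fin n) :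
    Repr (jetPartial σ i F) (pd σ i a) := by
  rw [jetPartial_eq_lineD]
  exact h.lineD _

theorem finsum_eq_range {M : Type*} [AddCommMonoid M] {f : ℕ → M} {N : ℕ}
    (h : ∀ σ, N ≤ σ → f σ = 0) : ∑ᶠ σ, f σ = ∑ σ ∈ Finset.range N, f σ := by
  refine finsum_eq_finsetSum_of_support_subset _ fun σ hσ => ?_
  simp only [Finset.coe_range, Set.mem_Iio]
  by_contra hc
  exact hσ (h σ (by omega))

/-- The sum of a locally finite sequence of derivations. -/
def finsumDer {R : Type*} [CommRing R] [Algebra ℝ R] (δ : ℕ → Derivation ℝ R R)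
    (hδ : ∀ a, ∃ N, ∀ σ, N ≤ σ → δ σ a = 0) : Derivation ℝ R R := by
  have hfin : ∀ a, (Function.support fun σ => δ σ a).Finite := fun a => by
    obtain ⟨N, hN⟩ := hδ a
    refine (Set.finite_Iio N).subset fun σ hσ => ?_
    by_contra hc
    exact hσ (hN σ (by simpa using hc))
  refine Derivation.mk' ⟨⟨fun a => ∑ᶠ σ, δ σ a, ?_⟩, ?_⟩ ?_
  · intro a b
    rw [← finsum_add_distrib (hfin a) (hfin b)]
    simp only [map_add]
  · intro r a
    simp only [Derivation.map_smul, RingHom.id_apply]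
    exact (smul_finsum' r (hfin a)).symm
  · intro a b
    simp only [LinearMap.coe_mk, AddHom.coe_mk, Derivation.leibniz]
    rw [smul_finsum' a (hfin b), smul_finsum' b (hfin a), ← finsum_add_distrib]
    · exact (hfin b).subset fun σ hσ h0 => hσ (by simp only [h0, smul_zero])
    · exact (hfin a).subset fun σ hσ h0 => hσ (by simp only [h0, smul_zero])

/-- The bound is stated for every larger `M` as well, so that several differential functions can
share one summation range. -/
theorem exists_order (a : DiffAlg U) : ∃ N, ∀ M, N ≤ M → ∀ σ, M ≤ σ → ∀ i, pd σ i a = 0 := by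
  obtain ⟨N, hN⟩ := exists_pd_eq_zero a
  exact ⟨N + 1, fun M hM σ hσ i => hN σ (by omega) i⟩

theorem sum_smul_pd_apply (v : ℕ → Fin n → DiffAlg U) (σ : ℕ) (a : DiffAlg U) :
    (∑ i, v σ i • pd σ i : Derivation ℝ (DiffAlg U) (DiffAlg U)) a
      = ∑ i, v σ i * pd σ i a := by
  rw [← Derivation.coeFnAddMonoidHom_apply, map_sum, Finset.sum_apply]
  rfl

/-- The derivation `∑ v^i_σ ∂/∂u^i_σ`. -/
def vecD (v : ℕ → Fin n → DiffAlg U) : Derivation ℝ (DiffAlg U) (DiffAlg U) :=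
  finsumDer (fun σ => ∑ i, v σ i • pd σ i) fun a => by
    obtain ⟨N, hN⟩ := exists_order a
    refine ⟨N, fun σ hσ => ?_⟩
    rw [sum_smul_pd_apply]
    exact Finset.sum_eq_zero fun i _ => by rw [hN N le_rfl σ hσ, mul_zero]

theorem vecD_eq_range (v : ℕ → Fin n → DiffAlg U) {a : DiffAlg U} {N : ℕ}
    (h : ∀ σ, N ≤ σ → ∀ i, pd σ i a = 0) :
    vecD v a = ∑ σ ∈ Finset.range N, ∑ i : Fin n, v σ i * pd σ i a := by
  have h1 : vecD v a = ∑ᶠ σ, (∑ i, v σ i • pd σ i : Derivation ℝ (DiffAlg U) (DiffAlg U)) a :=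
    rfl
  rw [h1]
  simp only [sum_smul_pd_apply]
  exact finsum_eq_range fun σ hσ => Finset.sum_eq_zero fun i _ => by rw [h σ hσ i, mul_zero]

theorem pd_coord (σ τ : ℕ) (i j : Fin n) :
    pd σ i (coord U τ j) = if σ = τ ∧ i = j then 1 else 0 := by
  rw [dirD_coord]
  by_cases h : σ = τ
  · subst h
    by_cases hi : i = j
    · subst hi; simp [dirJ]
    · simp [dirJ, hi, Ne.symm hi]
  · simp [dirJ, h, Ne.symm h]

theorem vecD_coord (v : ℕ → Fin n → DiffAlg U) (τ : ℕ) (j : Fin n) :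
    vecD v (coord U τ j) = v τ j := by
  rw [vecD_eq_range v (N := τ + 1) fun σ hσ i => by
    rw [pd_coord, if_neg]; omega]
  rw [Finset.sum_eq_single τ]
  · simp [pd_coord]
  · intro σ _ hσ
    simp [pd_coord, hσ]
  · simp

/-- The total derivative on differential functions. -/
def D : Derivation ℝ (DiffAlg U) (DiffAlg U) :=
  dirD (1, 0) + vecD fun σ i => coord U (σ + 1) i

theorem repr_vecD {V : ℕ → Fin n → JetFun n} {v : ℕ → Fin n → DiffAlg U}
    (hV : ∀ σ i, Repr (V σ i) (v σ i)) {F : JetFun n} {a : DiffAlg U} (h : Repr F a) :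
    Repr (fun x J => ∑ᶠ σ : ℕ, ∑ i : Fin n, V σ i x J * HydroJet.lineD (dirJ σ i) F x J)
      (vecD v a) := by
  obtain ⟨N, hN⟩ := exists_order a
  rw [vecD_eq_range v (hN N le_rfl)]
  intro x J hJ
  beta_reduce
  rw [finsum_eq_range (N := N)]
  · exact Repr.sum _ (fun σ _ => Repr.sum _ fun i _ => (hV σ i).mul (h.lineD _)) x J hJ
  · intro σ hσ
    refine Finset.sum_eq_zero fun i _ => ?_
    rw [h.lineD (dirJ σ i) x J hJ, hN N le_rfl σ hσ i]
    exact mul_zero _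

theorem Repr.totalD {F : JetFun n} {a : DiffAlg U} (h : Repr F a) : Repr (totalD F) (D a) := by
  rw [totalD_eq_lineD]
  exact (h.lineD _).add (repr_vecD (fun σ i => repr_coord (σ + 1) i) h)

theorem Repr.iterate_totalD {F : JetFun n} {a : DiffAlg U} (h : Repr F a) (k : ℕ) :
    Repr (HydroJet.totalD^[k] F) (D^[k] a) := by
  induction k with
  | zero => exact h
  | succ k ih =>
    rw [Function.iterate_succ_apply', Function.iterate_succ_apply']
    exact ih.totalD

/-- The evolutionary derivation with characteristic `φ`. -/
def ev (φ : Fin n → DiffAlg U) : Derivation ℝ (DiffAlg U) (DiffAlg U) :=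
  vecD fun σ i => D^[σ] (φ i)

theorem ev_coord (φ : Fin n → DiffAlg U) (σ : ℕ) (i : Fin n) :
    ev φ (coord U σ i) = D^[σ] (φ i) := vecD_coord _ _ _

/-- The constant direction commutes with all partial derivatives, so the commutator comes only from
differentiating the coefficients u^i_{σ+1} of `D`. The cases ∂/∂u^i_0 and ∂/∂u^i_{σ+1} below give
[∂_0, D] = 0 and [∂_{σ+1}, D] = ∂_σ. -/
theorem dirD_D (c : ℝ × Jet n) (a : DiffAlg U) :
    dirD c (D a) = D (dirD c a) + vecD (fun σ i => algebraMap ℝ _ (c.2 (σ + 1) i)) a := by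
  obtain ⟨N, hN⟩ := exists_order a
  have ha := hN N le_rfl
  have hc : ∀ σ, N ≤ σ → ∀ i, pd σ i (dirD c a) = 0 := fun σ hσ i => by
    rw [dirD_comm, ha σ hσ, map_zero]
  rw [D, Derivation.add_apply, Derivation.add_apply, vecD_eq_range _ ha, vecD_eq_range _ hc,
    vecD_eq_range _ ha, map_add, dirD_comm c, add_assoc, ← Finset.sum_add_distrib]
  simp only [map_sum, Derivation.leibniz, dirD_coord, smul_eq_mul, ← Finset.sum_add_distrib]
  congr 1
  refine Finset.sum_congr rfl fun σ _ => Finset.sum_congr rfl fun i _ => ?_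
  rw [dirD_comm c]
  ring

theorem pd_D_zero (i : Fin n) (a : DiffAlg U) : pd 0 i (D a) = D (pd 0 i a) := by
  rw [dirD_D, add_eq_left]
  obtain ⟨N, hN⟩ := exists_order a
  rw [vecD_eq_range _ (hN N le_rfl)]
  simp [dirJ]

theorem pd_D_succ (σ : ℕ) (i : Fin n) (a : DiffAlg U) :
    pd (σ + 1) i (D a) = D (pd (σ + 1) i a) + pd σ i a := by
  rw [dirD_D]
  congr 1
  obtain ⟨N, hN⟩ := exists_order a
  have ha := hN (max N (σ + 1)) (le_max_left _ _)
  rw [vecD_eq_range _ ha, Finset.sum_eq_single σ]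
  · rw [Finset.sum_eq_single i]
    · simp [dirJ]
    · intro j _ hj
      simp [dirJ, hj]
    · simp
  · intro τ _ hτ
    refine Finset.sum_eq_zero fun j _ => ?_
    simp [dirJ, hτ]
  · intro h
    simp at h

/-- The commutators [∂_{σ+1}, D] = ∂_σ contribute ∑ D^{σ+1}φ ∂_σ a, which is exactly what D produces
from the coefficients D^σ φ of `ev φ`. -/
theorem ev_D (φ : Fin n → DiffAlg U) (a : DiffAlg U) : ev φ (D a) = D (ev φ a) := by
  obtain ⟨N, hN⟩ := exists_order a
  obtain ⟨M, hM⟩ := exists_order (D a)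
  have ha := hN (max N M) (le_max_left _ _)
  have hD := hM (max N M + 1) ((le_max_right _ _).trans (Nat.le_succ _))
  rw [ev, vecD_eq_range _ hD, vecD_eq_range _ (N := max N M + 1)
    fun σ hσ i => ha σ (by omega) i]
  have hlast : ∀ i, D (pd (max N M) i a) = 0 := fun i => by rw [ha _ le_rfl, map_zero]
  -- The range is one longer than `a` requires: splitting off σ = 0 leaves the shifted sum over the
  -- original range, and the extra last term vanishes.
  rw [Finset.sum_range_succ' _ (max N M)]
  simp only [map_sum, Derivation.leibniz, smul_eq_mul, pd_D_succ, pd_D_zero, mul_add,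
    Finset.sum_add_distrib]
  have h1 := Finset.sum_range_succ' (fun σ => ∑ i, D^[σ] (φ i) * D (pd σ i a)) (max N M)
  have h2 := Finset.sum_range_succ (fun σ => ∑ i, D^[σ + 1] (φ i) * pd σ i a) (max N M)
  simp only [ha _ le_rfl, mul_zero, Finset.sum_const_zero, add_zero] at h2
  rw [h1]
  simp only [mul_comm (pd _ _ a), ← Function.iterate_succ_apply' D]
  rw [h2]
  abel

theorem ev_iterate_D (φ : Fin n → DiffAlg U) (k : ℕ) (a : DiffAlg U) :
    ev φ (D^[k] a) = D^[k] (ev φ a) := by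
  induction k with
  | zero => rfl
  | succ k ih => rw [Function.iterate_succ_apply', ev_D, ih, Function.iterate_succ_apply']

end DifferentialAlgebra

/-! ### Scalar differential operators over a ring with a derivation -/

section DiffOps

variable {R : Type*} [CommRing R] [Algebra ℝ R] (δ : Derivation ℝ R R)

theorem iterate_derivation_sum {ι : Type*} (s : Finset ι) (f : ι → R) (k : ℕ) :
    δ^[k] (∑ i ∈ s, f i) = ∑ i ∈ s, δ^[k] (f i) := by
  induction k with
  | zero => rfl
  | succ k ih => simp only [Function.iterate_succ_apply', ih, map_sum]

theorem iterate_derivation_mul (k : ℕ) (a b : R) :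
    δ^[k] (a * b) = ∑ j ∈ Finset.range (k + 1), (k.choose j : R) * δ^[j] a * δ^[k - j] b := by
  rw [← Finset.Nat.sum_antidiagonal_eq_sum_range_succ_mk
    (f := fun p : ℕ × ℕ => (k.choose p.1 : R) * δ^[p.1] a * δ^[p.2] b)]
  induction k with
  | zero => simp
  | succ k ih =>
    have h := Finset.sum_antidiagonal_choose_succ_mul (R := R)
      (fun i j => δ^[i] a * δ^[j] b) k
    simp only [mul_assoc] at ih ⊢
    rw [h, Function.iterate_succ_apply', ih, map_sum, ← Finset.sum_add_distrib]
    refine Finset.sum_congr rfl fun p hp => ?_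
    have hc : k.choose p.2 = k.choose p.1 :=
      (Nat.choose_symm_of_eq_add (by rw [← Finset.HasAntidiagonal.mem_antidiagonal.1 hp, add_comm]))
    simp only [Derivation.leibniz, Derivation.map_natCast, smul_eq_mul, hc,
      Function.iterate_succ_apply']
    ring

/-- The action of the differential operator with coefficients `b`. -/
def act (b : ℕ →₀ R) (χ : R) : R :=
  Finsupp.liftAddHom (fun σ => AddMonoidHom.mulRight (δ^[σ] χ)) b

theorem act_single (σ : ℕ) (a χ : R) : act δ (Finsupp.single σ a) χ = a * δ^[σ] χ := by
  simp [act]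

theorem act_add (a b : ℕ →₀ R) (χ : R) : act δ (a + b) χ = act δ a χ + act δ b χ :=
  map_add _ a b

theorem act_zero (χ : R) : act δ 0 χ = 0 := map_zero _

theorem act_smul (r : ℝ) (b : ℕ →₀ R) (χ : R) : act δ (r • b) χ = r • act δ b χ := by
  simp only [act, Finsupp.liftAddHom_apply, Finsupp.smul_sum]
  rw [Finsupp.sum_smul_index' (by simp)]
  simp

theorem act_sum {ι : Type*} (s : Finset ι) (f : ι → ℕ →₀ R) (χ : R) :
    act δ (∑ i ∈ s, f i) χ = ∑ i ∈ s, act δ (f i) χ :=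
  map_sum _ f s

theorem act_eq_range (b : ℕ →₀ R) {M : ℕ} (h : b.support ⊆ Finset.range M) (χ : R) :
    act δ b χ = ∑ σ ∈ Finset.range M, b σ * δ^[σ] χ := by
  simp only [act, Finsupp.liftAddHom_apply]
  exact Finsupp.sum_of_support_subset _ h _ (by simp)

/-- The composition of differential operators. -/
def comp (a b : ℕ →₀ R) : ℕ →₀ R :=
  a.sum fun σ α => b.sum fun τ β => ∑ k ∈ Finset.range (σ + 1),
    Finsupp.single (σ - k + τ) ((σ.choose k : R) * α * δ^[k] β)

theorem comp_eq_range (a b : ℕ →₀ R) {M : ℕ} (ha : a.support ⊆ Finset.range M)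
    (hb : b.support ⊆ Finset.range M) :
    comp δ a b = ∑ σ ∈ Finset.range M, ∑ τ ∈ Finset.range M, ∑ k ∈ Finset.range (σ + 1),
      Finsupp.single (σ - k + τ) ((σ.choose k : R) * a σ * δ^[k] (b τ)) := by
  rw [comp, Finsupp.sum_of_support_subset _ ha _ (by simp)]
  refine Finset.sum_congr rfl fun σ _ => ?_
  exact Finsupp.sum_of_support_subset _ hb _ (by simp)

theorem exists_support_subset₂ {M N : Type*} [Zero M] [Zero N] (a : ℕ →₀ M) (b : ℕ →₀ N) :
    ∃ K, a.support ⊆ Finset.range K ∧ b.support ⊆ Finset.range K := by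
  obtain ⟨K, hK⟩ := (a.support ∪ b.support).exists_nat_subset_range
  exact ⟨K, Finset.union_subset_left hK, Finset.union_subset_right hK⟩

theorem act_comp (a b : ℕ →₀ R) (χ : R) : act δ (comp δ a b) χ = act δ a (act δ b χ) := by
  obtain ⟨M, ha, hb⟩ := exists_support_subset₂ a b
  rw [comp_eq_range δ a b ha hb, act_eq_range δ a ha, act_eq_range δ b hb]
  simp only [act_sum, act_single, iterate_derivation_sum, Finset.mul_sum]
  refine Finset.sum_congr rfl fun σ _ => Finset.sum_congr rfl fun τ _ => ?_
  rw [iterate_derivation_mul, Finset.mul_sum]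
  refine Finset.sum_congr rfl fun k _ => ?_
  rw [← Function.iterate_add_apply]
  ring

/-- The coefficientwise action of a derivation on a differential operator. -/
def coeffD (ε : Derivation ℝ R R) (b : ℕ →₀ R) : ℕ →₀ R := b.mapRange ε (map_zero ε)

theorem coeffD_single (ε : Derivation ℝ R R) (σ : ℕ) (a : R) :
    coeffD ε (Finsupp.single σ a) = Finsupp.single σ (ε a) := by
  simp [coeffD]

theorem coeffD_add (ε : Derivation ℝ R R) (a b : ℕ →₀ R) :
    coeffD ε (a + b) = coeffD ε a + coeffD ε b :=
  Finsupp.mapRange_add (map_add ε) a b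

theorem coeffD_smul (ε : Derivation ℝ R R) (r : ℝ) (b : ℕ →₀ R) :
    coeffD ε (r • b) = r • coeffD ε b := by
  ext σ
  simp [coeffD]

theorem coeffD_sum (ε : Derivation ℝ R R) {ι : Type*} (s : Finset ι) (f : ι → ℕ →₀ R) :
    coeffD ε (∑ i ∈ s, f i) = ∑ i ∈ s, coeffD ε (f i) := by
  ext σ
  simp [coeffD, Finsupp.finsetSum_apply]

theorem coeffD_apply (ε : Derivation ℝ R R) (b : ℕ →₀ R) (σ : ℕ) :
    coeffD ε b σ = ε (b σ) := by
  simp [coeffD]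

theorem coeffD_support (ε : Derivation ℝ R R) {b : ℕ →₀ R} {M : ℕ}
    (h : b.support ⊆ Finset.range M) : (coeffD ε b).support ⊆ Finset.range M :=
  Finsupp.support_mapRange.trans h

/-- Coefficients of a composition are products of coefficients of `a` and derivatives of
coefficients of `b`. A derivation commuting with the powers of δ therefore obeys the Leibniz rule
for composition; `ev φ` is such a derivation. -/
theorem coeffD_comp (ε : Derivation ℝ R R) (h : ∀ k a, ε (δ^[k] a) = δ^[k] (ε a))
    (a b : ℕ →₀ R) :
    coeffD ε (comp δ a b) = comp δ (coeffD ε a) b + comp δ a (coeffD ε b) := by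
  obtain ⟨M, ha, hb⟩ := exists_support_subset₂ a b
  rw [comp_eq_range δ a b ha hb, comp_eq_range δ _ b (coeffD_support ε ha) hb,
    comp_eq_range δ a _ ha (coeffD_support ε hb)]
  simp only [coeffD_sum, coeffD_single, ← Finset.sum_add_distrib, ← Finsupp.single_add,
    coeffD_apply]
  refine Finset.sum_congr rfl fun σ _ => Finset.sum_congr rfl fun τ _ =>
    Finset.sum_congr rfl fun k _ => congrArg _ ?_
  simp only [Derivation.leibniz, Derivation.map_natCast, smul_eq_mul, h]
  ring

end DiffOps

/-! ### From coefficient operators to maps on differential functions -/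

section OperatorSemantics

variable {n : ℕ} {U : Opens (Fin n → ℝ)}

/-- The differential operator `B` has the coefficients `b` over `U`. -/
def OpRepr (B : DiffOp n) (b : ℕ →₀ DiffAlg U) : Prop := ∀ σ, Repr (B σ) (b σ)

theorem OpRepr.add {A B : DiffOp n} {a b : ℕ →₀ DiffAlg U} (hA : OpRepr A a) (hB : OpRepr B b) :
    OpRepr (A + B) (a + b) := fun σ => (hA σ).add (hB σ)

theorem OpRepr.smul (r : ℝ) {B : DiffOp n} {b : ℕ →₀ DiffAlg U} (hB : OpRepr B b) :
    OpRepr (r • B) (r • b) := fun σ x J h => congrArg (r * ·) (hB σ x J h)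

theorem opRepr_zero : OpRepr (0 : DiffOp n) (0 : ℕ →₀ DiffAlg U) := fun _ => repr_zero

theorem OpRepr.single (k : ℕ) {F : JetFun n} {a : DiffAlg U} (h : Repr F a) :
    OpRepr (Finsupp.single k F) (Finsupp.single k a) := fun σ => by
  by_cases hσ : k = σ
  · subst hσ
    simpa using h
  · rw [Finsupp.single_eq_of_ne (Ne.symm hσ), Finsupp.single_eq_of_ne (Ne.symm hσ)]
    exact repr_zero

theorem OpRepr.sum {ι : Type*} (s : Finset ι) {F : ι → DiffOp n} {a : ι → ℕ →₀ DiffAlg U}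
    (h : ∀ i ∈ s, OpRepr (F i) (a i)) : OpRepr (∑ i ∈ s, F i) (∑ i ∈ s, a i) := by
  classical
  induction s using Finset.induction_on with
  | empty => simpa using opRepr_zero
  | insert i s hi ih =>
    simp only [Finset.sum_insert hi]
    exact (h i (by simp)).add (ih fun j hj => h j (by simp [hj]))

/-- A coefficient of `B` may vanish over `U` without being zero on the jet space, so the supports of
`B` and `b` can differ; a common range allows their sums to be compared. -/
theorem exists_support_subset₄ {A B : DiffOp n} {a b : ℕ →₀ DiffAlg U} :
    ∃ K, (A.support ⊆ Finset.range K ∧ B.support ⊆ Finset.range K) ∧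
      a.support ⊆ Finset.range K ∧ b.support ⊆ Finset.range K := by
  obtain ⟨K, hA, hB⟩ := exists_support_subset₂ A B
  obtain ⟨L, ha, hb⟩ := exists_support_subset₂ a b
  have hK : Finset.range K ⊆ Finset.range (max K L) := Finset.range_mono (le_max_left _ _)
  have hL : Finset.range L ⊆ Finset.range (max K L) := Finset.range_mono (le_max_right _ _)
  exact ⟨max K L, ⟨hA.trans hK, hB.trans hK⟩, ha.trans hL, hb.trans hL⟩

theorem totalD_zero : totalD (0 : JetFun n) = 0 := by
  funext x J
  simp [totalD, jetPartial]

theorem iterate_totalD_zero (k : ℕ) : totalD^[k] (0 : JetFun n) = 0 :=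
  Function.iterate_fixed totalD_zero k

theorem OpRepr.opComp {A B : DiffOp n} {a b : ℕ →₀ DiffAlg U} (hA : OpRepr A a)
    (hB : OpRepr B b) : OpRepr (opComp A B) (comp D a b) := by
  obtain ⟨M, ⟨hA', hB'⟩, ha, hb⟩ := exists_support_subset₄ (A := A) (B := B) (a := a) (b := b)
  have h : HydroJet.opComp A B = ∑ σ ∈ Finset.range M, ∑ τ ∈ Finset.range M,
      ∑ k ∈ Finset.range (σ + 1), Finsupp.single (σ - k + τ)
        (fun x J => (σ.choose k : ℝ) * A σ x J * (totalD^[k] (B τ)) x J) := by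
    have hz : (fun (_ : ℝ) (_ : Jet n) => (0 : ℝ)) = 0 := rfl
    rw [HydroJet.opComp, Finsupp.sum_of_support_subset _ hA' _ (by simp [hz])]
    refine Finset.sum_congr rfl fun σ _ => ?_
    exact Finsupp.sum_of_support_subset _ hB' _ (by simp [iterate_totalD_zero, hz])
  rw [h, comp_eq_range D a b ha hb]
  refine OpRepr.sum _ fun σ _ => OpRepr.sum _ fun τ _ => OpRepr.sum _ fun k _ =>
    OpRepr.single _ ?_
  refine Repr.mul (Repr.mul ?_ (hA σ)) ((hB τ).iterate_totalD k)
  simpa using repr_const (U := U) (σ.choose k : ℝ)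

theorem OpRepr.act {B : DiffOp n} {b : ℕ →₀ DiffAlg U} (hB : OpRepr B b) {F : JetFun n}
    {χ : DiffAlg U} (hF : Repr F χ) :
    Repr (fun x J => B.sum fun σ a => a x J * (HydroJet.totalD^[σ] F) x J) (act D b χ) := by
  obtain ⟨M, hB', hb⟩ := exists_support_subset₂ B b
  rw [act_eq_range D b hb]
  intro x J hJ
  beta_reduce
  rw [Finsupp.sum_of_support_subset _ hB' _ (by simp)]
  exact Repr.sum _ (fun σ _ => (hB σ).mul (hF.iterate_totalD σ)) x J hJ

/-- The inner double sum in the definition of ℓ is the evolutionary derivative of one coefficient,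
times the differentiated covector. -/
theorem Repr.ev_mul {a χ : DiffAlg U} {G F : JetFun n} {Φ : Fin n → JetFun n}
    {φ : Fin n → DiffAlg U} (ha : Repr G a) (hF : Repr F χ) (hΦ : ∀ s, Repr (Φ s) (φ s)) :
    Repr (fun x J => ∑ᶠ τ : ℕ, ∑ s : Fin n,
      HydroJet.jetPartial τ s G x J * F x J * (HydroJet.totalD^[τ] (Φ s)) x J)
      (ev φ a * χ) := by
  obtain ⟨N, hN⟩ := exists_order a
  rw [ev, vecD_eq_range _ (hN N le_rfl), Finset.sum_mul]
  simp only [Finset.sum_mul]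
  intro x J hJ
  beta_reduce
  rw [finsum_eq_range (N := N)]
  · refine Repr.sum _ (F := fun σ x J => ∑ s, HydroJet.jetPartial σ s G x J * F x J
      * (HydroJet.totalD^[σ] (Φ s)) x J) (fun σ _ => Repr.sum _ fun i _ => ?_) x J hJ
    rw [mul_comm (D^[σ] (φ i)), mul_right_comm]
    exact ((ha.jetPartial σ i).mul hF).mul ((hΦ i).iterate_totalD σ)
  · intro σ hσ
    refine Finset.sum_eq_zero fun i _ => ?_
    rw [ha.jetPartial σ i x J hJ, hN N le_rfl σ hσ i]
    exact mul_eq_zero_of_left (zero_mul _) _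

theorem OpRepr.linearize {B : DiffOp n} {b : ℕ →₀ DiffAlg U} (hB : OpRepr B b) {F : JetFun n}
    {χ : DiffAlg U} (hF : Repr F χ) {Φ : Fin n → JetFun n} {φ : Fin n → DiffAlg U}
    (hΦ : ∀ s, Repr (Φ s) (φ s)) :
    Repr (fun x J => B.sum fun σ a => ∑ᶠ τ : ℕ, ∑ s : Fin n,
        HydroJet.jetPartial τ s a x J * (HydroJet.totalD^[σ] F) x J
          * (HydroJet.totalD^[τ] (Φ s)) x J)
      (HydroJet.act D (coeffD (ev φ) b) χ) := by
  obtain ⟨M, hB', hb⟩ := exists_support_subset₂ B b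
  rw [act_eq_range D _ (coeffD_support _ hb)]
  intro x J hJ
  beta_reduce
  rw [Finsupp.sum_of_support_subset _ hB' _ (by simp [HydroJet.jetPartial])]
  refine Repr.sum _ (F := fun σ x J => ∑ᶠ τ : ℕ, ∑ s : Fin n,
    HydroJet.jetPartial τ s (B σ) x J * (HydroJet.totalD^[σ] F) x J
      * (HydroJet.totalD^[τ] (Φ s)) x J) (fun σ _ => ?_) x J hJ
  rw [coeffD_apply]
  exact (hB σ).ev_mul (hF.iterate_totalD σ) hΦ

/-- The differential operator `B` acts over `U` by `T`, and its linearization is `L`. -/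
def OpSem (B : DiffOp n) (T : DiffAlg U → DiffAlg U)
    (L : (Fin n → DiffAlg U) → DiffAlg U → DiffAlg U) : Prop :=
  ∃ b : ℕ →₀ DiffAlg U, OpRepr B b ∧ (∀ χ, act D b χ = T χ) ∧
    ∀ φ χ, act D (coeffD (ev φ) b) χ = L φ χ

theorem opSem_opD : OpSem (U := U) opD (fun χ => D χ) (fun _ _ => 0) :=
  ⟨Finsupp.single 1 1, OpRepr.single 1 repr_one, by simp [act_single],
    by simp [coeffD_single, act_zero]⟩

theorem opSem_opMul {F : JetFun n} {a : DiffAlg U} (h : Repr F a) :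
    OpSem (opMul F) (fun χ => a * χ) (fun φ χ => ev φ a * χ) :=
  ⟨Finsupp.single 0 a, OpRepr.single 0 h, by simp [act_single],
    by simp [coeffD_single, act_single]⟩

section Rules

variable {A B : DiffOp n} {S T : DiffAlg U → DiffAlg U}
  {K L : (Fin n → DiffAlg U) → DiffAlg U → DiffAlg U}

theorem OpSem.add (hA : OpSem A S K) (hB : OpSem B T L) :
    OpSem (A + B) (fun χ => S χ + T χ) (fun φ χ => K φ χ + L φ χ) := by
  obtain ⟨a, ha, hS, hK⟩ := hA
  obtain ⟨b, hb, hT, hL⟩ := hB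
  exact ⟨a + b, ha.add hb, by simp [act_add, hS, hT], by simp [coeffD_add, act_add, hK, hL]⟩

theorem OpSem.smul (r : ℝ) (hB : OpSem B T L) :
    OpSem (r • B) (fun χ => r • T χ) (fun φ χ => r • L φ χ) := by
  obtain ⟨b, hb, hT, hL⟩ := hB
  exact ⟨r • b, hb.smul r, by simp [act_smul, hT], by simp [coeffD_smul, act_smul, hL]⟩

theorem OpSem.comp (hA : OpSem A S K) (hB : OpSem B T L) :
    OpSem (opComp A B) (fun χ => S (T χ)) (fun φ χ => K φ (T χ) + S (L φ χ)) := by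
  obtain ⟨a, ha, hS, hK⟩ := hA
  obtain ⟨b, hb, hT, hL⟩ := hB
  refine ⟨_, ha.opComp hb, fun χ => by rw [act_comp, hT, hS], fun φ χ => ?_⟩
  rw [coeffD_comp D _ (ev_iterate_D φ), act_add, act_comp, act_comp, hT, hL, hK, hS]

end Rules

theorem Repr.pairing {Ψ Φ : Fin n → JetFun n} {ψ φ : Fin n → DiffAlg U}
    (hΨ : ∀ i, Repr (Ψ i) (ψ i)) (hΦ : ∀ i, Repr (Φ i) (φ i)) :
    Repr (pairing Ψ Φ) (∑ i, ψ i * φ i) :=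
  Repr.sum _ fun i _ => (hΨ i).mul (hΦ i)

theorem Repr.isTotalDiv {F : JetFun n} {a : DiffAlg U} (h : Repr F a) (ha : ∃ q, a = D q) :
    IsTotalDiv (U : Set (Fin n → ℝ)) F := by
  obtain ⟨q, rfl⟩ := ha
  have hq := repr_ext0 q
  exact ⟨ext0 q, hq.isDiffFun, fun x J hJ => (h x J hJ).trans (hq.totalD x J hJ).symm⟩

section Criterion

variable {A : MatDiffOp n} {T : Fin n → Fin n → DiffAlg U → DiffAlg U}
  {L : Fin n → Fin n → (Fin n → DiffAlg U) → DiffAlg U → DiffAlg U}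

theorem repr_apply (h : ∀ i j, OpSem (A i j) (T i j) (L i j)) {Ψ : Fin n → JetFun n}
    {ψ : Fin n → DiffAlg U} (hΨ : ∀ i, Repr (Ψ i) (ψ i)) (i : Fin n) :
    Repr (A.apply Ψ i) (∑ j, T i j (ψ j)) := by
  refine Repr.sum _ fun j _ => ?_
  obtain ⟨b, hb, hT, -⟩ := h i j
  rw [← hT]
  exact hb.act (hΨ j)

theorem repr_linearize (h : ∀ i j, OpSem (A i j) (T i j) (L i j)) {Ψ Φ : Fin n → JetFun n}
    {ψ φ : Fin n → DiffAlg U} (hΨ : ∀ i, Repr (Ψ i) (ψ i)) (hΦ : ∀ i, Repr (Φ i) (φ i))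
    (i : Fin n) : Repr (A.linearize Ψ Φ i) (∑ j, L i j φ (ψ j)) := by
  refine Repr.sum _ fun j _ => ?_
  obtain ⟨b, hb, -, hL⟩ := h i j
  rw [← hL]
  exact hb.linearize (hΨ j) hΦ

/-- Transfers the two Hamiltonian conditions to the differential algebra, where T and L are the
entrywise action and linearization. -/
theorem isHamiltonian_of_opSem (h : ∀ i j, OpSem (A i j) (T i j) (L i j))
    (skew : ∀ ψ φ : Fin n → DiffAlg U,
      ∃ q, ∑ i, ψ i * ∑ j, T i j (φ j) + ∑ i, φ i * ∑ j, T i j (ψ j) = D q)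
    (jacobi : ∀ ψ₁ ψ₂ ψ₃ : Fin n → DiffAlg U,
      ∃ q, ∑ i, ψ₃ i * ∑ j, L i j (fun s => ∑ t, T s t (ψ₂ t)) (ψ₁ j)
        + ∑ i, ψ₁ i * ∑ j, L i j (fun s => ∑ t, T s t (ψ₃ t)) (ψ₂ j)
        + ∑ i, ψ₂ i * ∑ j, L i j (fun s => ∑ t, T s t (ψ₁ t)) (ψ₃ j) = D q) :
    IsHamiltonian (U : Set (Fin n → ℝ)) A where
  coeff i j σ := by
    obtain ⟨b, hb, -⟩ := h i j
    exact (hb σ).isDiffFun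
  skew Ψ Φ hΨ hΦ := by
    choose ψ hψ using fun i => exists_repr (hΨ i)
    choose φ hφ using fun i => exists_repr (hΦ i)
    exact ((Repr.pairing hψ (repr_apply h hφ)).add
      (Repr.pairing hφ (repr_apply h hψ))).isTotalDiv (skew ψ φ)
  jacobi Ψ₁ Ψ₂ Ψ₃ h₁ h₂ h₃ := by
    choose ψ₁ h₁ using fun i => exists_repr (h₁ i)
    choose ψ₂ h₂ using fun i => exists_repr (h₂ i)
    choose ψ₃ h₃ using fun i => exists_repr (h₃ i)
    have r₁ := Repr.pairing h₃ (repr_linearize h h₁ (repr_apply h h₂))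
    have r₂ := Repr.pairing h₁ (repr_linearize h h₂ (repr_apply h h₃))
    have r₃ := Repr.pairing h₂ (repr_linearize h h₃ (repr_apply h h₁))
    have hr := ((((r₁.add r₂).add r₃).add r₁).add r₂).add r₃
    refine Repr.isTotalDiv (F := schouten A A Ψ₁ Ψ₂ Ψ₃) hr ?_
    obtain ⟨q, hq⟩ := jacobi ψ₁ ψ₂ ψ₃
    -- For equal arguments the six terms of the bracket are the three cyclic terms taken twice.
    refine ⟨q + q, ?_⟩
    rw [map_add, ← hq]
    abel

end Criterion

end OperatorSemantics

/-! ### The algebraic identities behind skew-adjointness and the Jacobi identity -/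

section Identities

variable {R : Type*} [CommRing R] [Algebra ℝ R] (δ : Derivation ℝ R R)

theorem derivation_two (ε : Derivation ℝ R R) : ε 2 = 0 := by
  exact_mod_cast ε.map_natCast 2

/-- The operator `bᵀ D + D b`. -/
def pT (b : Fin 2 → Fin 2 → R) (x : Fin 2 → R) : Fin 2 → R := fun i =>
  ∑ j, (b j i * δ (x j) + δ (b i j * x j))

/-- The bilinear form `x' b z - z' b x`. -/
def pE (b : Fin 2 → Fin 2 → R) (x z : Fin 2 → R) : R :=
  ∑ i, ∑ j, (δ (x i) * b i j * z j - δ (z i) * b i j * x j)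

/-- The covector `Wᵀ D x`, for the matrix `W` with rows `(1, 0)` and `(a, ι)`. -/
def rP (a ι : R) (x : Fin 2 → R) : Fin 2 → R := ![δ (x 0) + a * δ (x 1), ι * δ (x 1)]

/-- The vector `W D p`, for the matrix `W` with rows `(1, 0)` and `(a, ι)`. -/
def rX (a ι : R) (p : Fin 2 → R) : Fin 2 → R := ![δ (p 0), a * δ (p 0) + ι * δ (p 1)]

/-- The operator `D W D Wᵀ D`. -/
def rT (a ι : R) (x : Fin 2 → R) : Fin 2 → R := fun i => δ (rX δ a ι (rP δ a ι x) i)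

/-- The variation of `W D Wᵀ D x` under a variation `a'`, `ι'` of `a`, `ι`. -/
def rV (a ι a' ι' : R) (x : Fin 2 → R) : Fin 2 → R :=
  ![δ (a' * δ (x 1)),
    a' * δ (rP δ a ι x 0) + ι' * δ (rP δ a ι x 1)
      + a * δ (a' * δ (x 1)) + ι * δ (ι' * δ (x 1))]

/-- The bilinear form `p₂ r_k' - r₂ p_k'`. -/
def rS (k : Fin 2) (p r : Fin 2 → R) : R := p 1 * δ (r k) - r 1 * δ (p k)

/-- The bilinear covector of the linearization of `D W D Wᵀ D`. -/
def rE (a ι : R) (p r : Fin 2 → R) : Fin 2 → R :=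
  ![-(a * rS δ 0 p r) - ι * rS δ 1 p r, rS δ 0 p r]

theorem pT_skew (b : Fin 2 → Fin 2 → R) (x y : Fin 2 → R) :
    ∑ i, x i * pT δ b y i + ∑ i, y i * pT δ b x i
      = δ (∑ i, ∑ j, (x i * b i j * y j + y i * b i j * x j)) := by
  simp only [pT, Fin.sum_univ_two, Derivation.leibniz, map_add, smul_eq_mul]
  ring

theorem rT_skew (a ι : R) (x y : Fin 2 → R) :
    ∑ i, x i * rT δ a ι y i + ∑ i, y i * rT δ a ι x i
      = δ (∑ i, (x i * rX δ a ι (rP δ a ι y) i + y i * rX δ a ι (rP δ a ι x) i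
          - rP δ a ι x i * rP δ a ι y i)) := by
  simp only [rT, rX, rP, Fin.sum_univ_two, Matrix.cons_val_zero, Matrix.cons_val_one,
    Derivation.leibniz, map_add, map_sub, smul_eq_mul]
  ring

/-- Integration by parts in D b. When b is replaced by its variation, `pE` contains that variation
undifferentiated. -/
theorem pairing_pT (b : Fin 2 → Fin 2 → R) (x z : Fin 2 → R) :
    ∑ i, z i * pT δ b x i = pE δ b x z + δ (∑ i, ∑ j, z i * b i j * x j) := by
  simp only [pT, pE, Fin.sum_univ_two, Derivation.leibniz, map_add, smul_eq_mul]
  ring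

/-- Integration by parts through D W D Wᵀ D, until neither a' nor ι' is differentiated.
Skew-symmetry in x and z appears because W enters the operator twice, once on each side of the
middle D. -/
theorem pairing_rV (a ι a' ι' : R) (x z : Fin 2 → R) :
    ∑ i, z i * δ (rV δ a ι a' ι' x i)
      = a' * (δ (x 1) * δ (rP δ a ι z 0) - δ (z 1) * δ (rP δ a ι x 0))
        + ι' * (δ (x 1) * δ (rP δ a ι z 1) - δ (z 1) * δ (rP δ a ι x 1))
        + δ (∑ i, z i * rV δ a ι a' ι' x i
          - (rP δ a ι z 0 * a' + rP δ a ι z 1 * ι') * δ (x 1)) := by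
  simp only [rV, rP, Fin.sum_univ_two, Matrix.cons_val_zero, Matrix.cons_val_one,
    Derivation.leibniz, map_add, map_sub, smul_eq_mul]
  ring

/-- The RR part of the Jacobi identity. Here p, q, r stand for WᵀDx, WᵀDy, WᵀDz, but they may be
arbitrary, and so may a and ι: the identity is purely differential-algebraic. -/
theorem cyclic_rE (a ι : R) (p q r : Fin 2 → R) :
    ∑ i, δ (rX δ a ι q i) * rE δ a ι p r i + ∑ i, δ (rX δ a ι r i) * rE δ a ι q p i
        + ∑ i, δ (rX δ a ι p i) * rE δ a ι r q i
      = δ (ι * (δ (q 1) * rS δ 0 p r + δ (r 1) * rS δ 0 q p + δ (p 1) * rS δ 0 r q)) := by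
  simp only [rX, rE, rS, Fin.sum_univ_two, Matrix.cons_val_zero, Matrix.cons_val_one,
    Derivation.leibniz, map_add, map_sub, smul_eq_mul]
  ring

/-- Two field variables `u`, `v`, the inverse `i` of `u`, and the constants of a pencil. -/
structure Pencil where
  (u v i g c₁ c₂ c₃ : R)
  u_mul_i : u * i = 1
  der_g : δ g = 0
  der_c₁ : δ c₁ = 0
  der_c₂ : δ c₂ = 0
  der_c₃ : δ c₃ = 0

namespace Pencil

variable {δ} (P : Pencil δ)

/-- The second flux. -/
def w : R := (P.v ^ 2 + 2 * P.g * P.v - 1) * P.i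

/-- The matrix `b` with `P = bᵀ D + D b`. -/
def b : Fin 2 → Fin 2 → R :=
  ![![P.c₃ * (P.v + P.g) - P.c₁ * P.u, P.c₁ * P.v + P.c₂ * P.u],
    ![P.c₃ * P.w - P.c₁ * P.v, P.c₁ * P.w + P.c₂ * (P.v + P.g)]]

/-- The derivatives of `b` with respect to the field variables. -/
def db : Fin 2 → Fin 2 → Fin 2 → R :=
  ![![![-P.c₁, P.c₂], ![-(P.c₃ * (P.w * P.i)), -(P.c₁ * (P.w * P.i))]],
    ![![P.c₃, P.c₁], ![P.c₃ * (2 * (P.v + P.g) * P.i) - P.c₁,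
      P.c₁ * (2 * (P.v + P.g) * P.i) + P.c₂]]]

theorem der_i (ε : Derivation ℝ R R) : ε P.i = -(P.i ^ 2 * ε P.u) := by
  have h := congrArg ε P.u_mul_i
  simp only [Derivation.leibniz, smul_eq_mul, Derivation.map_one_eq_zero] at h
  linear_combination P.i * h - ε P.i * P.u_mul_i

/-- The chain rule, valid for δ and for evolutionary derivations alike, since both annihilate the
constants of the pencil. -/
theorem der_b (ε : Derivation ℝ R R) (hg : ε P.g = 0) (h₁ : ε P.c₁ = 0) (h₂ : ε P.c₂ = 0)
    (h₃ : ε P.c₃ = 0) (i j : Fin 2) :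
    ε (P.b i j) = P.db 0 i j * ε P.u + P.db 1 i j * ε P.v := by
  fin_cases i <;> fin_cases j <;>
    simp [b, db, w, Derivation.leibniz, Derivation.leibniz_pow, hg, h₁, h₂, h₃, P.der_i,
      derivation_two] <;> ring

/-- The PP part of the Jacobi identity. It holds for arbitrary constants c₁, c₂, c₃, which is the
mutual compatibility of the three first-order operators. -/
theorem cyclic_pE (x y z : Fin 2 → R) :
    ∑ s, pT δ P.b y s * pE δ (P.db s) x z + ∑ s, pT δ P.b z s * pE δ (P.db s) y x
      + ∑ s, pT δ P.b x s * pE δ (P.db s) z y = 0 := by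
  simp only [pT, pE, Derivation.leibniz, smul_eq_mul,
    P.der_b δ P.der_g P.der_c₁ P.der_c₂ P.der_c₃]
  simp only [b, db, w, Fin.sum_univ_two, Matrix.cons_val_zero, Matrix.cons_val_one]
  -- The fluxes are polynomial in u, v and i, so the cyclic sum vanishes only modulo u i = 1; the
  -- long factor is the cofactor of that relation.
  linear_combination (
   - 4 * P.g * P.i * P.c₁ * P.c₃ * P.v * x 0 * δ (y 0) * δ (z 1)
      + 4 * P.g * P.i * P.c₁ * P.c₃ * P.v * x 0 * δ (z 0) * δ (y 1)
      + 4 * P.g * P.i * P.c₁ * P.c₃ * P.v * δ (x 0) * y 0 * δ (z 1)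
      - 4 * P.g * P.i * P.c₁ * P.c₃ * P.v * δ (x 0) * z 0 * δ (y 1)
      - 4 * P.g * P.i * P.c₁ * P.c₃ * P.v * y 0 * δ (z 0) * δ (x 1)
      + 4 * P.g * P.i * P.c₁ * P.c₃ * P.v * δ (y 0) * z 0 * δ (x 1)
      + 4 * P.g * P.i * P.c₁^2 * P.v * δ (x 0) * y 1 * δ (z 1)
      - 4 * P.g * P.i * P.c₁^2 * P.v * δ (x 0) * δ (y 1) * z 1
      - 4 * P.g * P.i * P.c₁^2 * P.v * δ (y 0) * x 1 * δ (z 1)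
      + 4 * P.g * P.i * P.c₁^2 * P.v * δ (y 0) * δ (x 1) * z 1
      + 4 * P.g * P.i * P.c₁^2 * P.v * δ (z 0) * x 1 * δ (y 1)
      - 4 * P.g * P.i * P.c₁^2 * P.v * δ (z 0) * δ (x 1) * y 1
      + 2 * P.g * P.c₁ * P.c₂ * δ (x 0) * y 1 * δ (z 1)
      - 2 * P.g * P.c₁ * P.c₂ * δ (x 0) * δ (y 1) * z 1
      - 2 * P.g * P.c₁ * P.c₂ * δ (y 0) * x 1 * δ (z 1)
      + 2 * P.g * P.c₁ * P.c₂ * δ (y 0) * δ (x 1) * z 1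
      + 2 * P.g * P.c₁ * P.c₂ * δ (z 0) * x 1 * δ (y 1)
      - 2 * P.g * P.c₁ * P.c₂ * δ (z 0) * δ (x 1) * y 1
      - 2 * P.g * P.c₂ * P.c₃ * x 0 * δ (y 0) * δ (z 1)
      + 2 * P.g * P.c₂ * P.c₃ * x 0 * δ (z 0) * δ (y 1)
      + 2 * P.g * P.c₂ * P.c₃ * δ (x 0) * y 0 * δ (z 1)
      - 2 * P.g * P.c₂ * P.c₃ * δ (x 0) * z 0 * δ (y 1)
      - 2 * P.g * P.c₂ * P.c₃ * y 0 * δ (z 0) * δ (x 1)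
      + 2 * P.g * P.c₂ * P.c₃ * δ (y 0) * z 0 * δ (x 1)
      - 2 * P.i * P.c₁ * P.c₃ * P.v^2 * x 0 * δ (y 0) * δ (z 1)
      + 2 * P.i * P.c₁ * P.c₃ * P.v^2 * x 0 * δ (z 0) * δ (y 1)
      + 2 * P.i * P.c₁ * P.c₃ * P.v^2 * δ (x 0) * y 0 * δ (z 1)
      - 2 * P.i * P.c₁ * P.c₃ * P.v^2 * δ (x 0) * z 0 * δ (y 1)
      - 2 * P.i * P.c₁ * P.c₃ * P.v^2 * y 0 * δ (z 0) * δ (x 1)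
      + 2 * P.i * P.c₁ * P.c₃ * P.v^2 * δ (y 0) * z 0 * δ (x 1)
      + 2 * P.i * P.c₁ * P.c₃ * x 0 * δ (y 0) * δ (z 1)
      - 2 * P.i * P.c₁ * P.c₃ * x 0 * δ (z 0) * δ (y 1)
      - 2 * P.i * P.c₁ * P.c₃ * δ (x 0) * y 0 * δ (z 1)
      + 2 * P.i * P.c₁ * P.c₃ * δ (x 0) * z 0 * δ (y 1)
      + 2 * P.i * P.c₁ * P.c₃ * y 0 * δ (z 0) * δ (x 1)
      - 2 * P.i * P.c₁ * P.c₃ * δ (y 0) * z 0 * δ (x 1)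
      + 2 * P.i * P.c₁^2 * P.v^2 * δ (x 0) * y 1 * δ (z 1)
      - 2 * P.i * P.c₁^2 * P.v^2 * δ (x 0) * δ (y 1) * z 1
      - 2 * P.i * P.c₁^2 * P.v^2 * δ (y 0) * x 1 * δ (z 1)
      + 2 * P.i * P.c₁^2 * P.v^2 * δ (y 0) * δ (x 1) * z 1
      + 2 * P.i * P.c₁^2 * P.v^2 * δ (z 0) * x 1 * δ (y 1)
      - 2 * P.i * P.c₁^2 * P.v^2 * δ (z 0) * δ (x 1) * y 1
      - 2 * P.i * P.c₁^2 * δ (x 0) * y 1 * δ (z 1) + 2 * P.i * P.c₁^2 * δ (x 0) * δ (y 1) * z 1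
      + 2 * P.i * P.c₁^2 * δ (y 0) * x 1 * δ (z 1) - 2 * P.i * P.c₁^2 * δ (y 0) * δ (x 1) * z 1
      - 2 * P.i * P.c₁^2 * δ (z 0) * x 1 * δ (y 1) + 2 * P.i * P.c₁^2 * δ (z 0) * δ (x 1) * y 1
      + 2 * P.c₁ * P.c₂ * P.v * δ (x 0) * y 1 * δ (z 1)
      - 2 * P.c₁ * P.c₂ * P.v * δ (x 0) * δ (y 1) * z 1
      - 2 * P.c₁ * P.c₂ * P.v * δ (y 0) * x 1 * δ (z 1)
      + 2 * P.c₁ * P.c₂ * P.v * δ (y 0) * δ (x 1) * z 1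
      + 2 * P.c₁ * P.c₂ * P.v * δ (z 0) * x 1 * δ (y 1)
      - 2 * P.c₁ * P.c₂ * P.v * δ (z 0) * δ (x 1) * y 1
      - 2 * P.c₂ * P.c₃ * P.v * x 0 * δ (y 0) * δ (z 1)
      + 2 * P.c₂ * P.c₃ * P.v * x 0 * δ (z 0) * δ (y 1)
      + 2 * P.c₂ * P.c₃ * P.v * δ (x 0) * y 0 * δ (z 1)
      - 2 * P.c₂ * P.c₃ * P.v * δ (x 0) * z 0 * δ (y 1)
      - 2 * P.c₂ * P.c₃ * P.v * y 0 * δ (z 0) * δ (x 1)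
      + 2 * P.c₂ * P.c₃ * P.v * δ (y 0) * z 0 * δ (x 1)) * P.u_mul_i

/-- The PR part of the Jacobi identity, with the outer D of R already moved onto `pE`. The
hypotheses invert p = WᵀDx, and likewise for q and r, so that first derivatives of the covectors are
expressed through p, q, r. -/
theorem cyclic_pE_rE {x y z p q r : Fin 2 → R}
    (hx₀ : δ (x 0) = p 0 - P.v * p 1) (hx₁ : δ (x 1) = P.u * p 1)
    (hy₀ : δ (y 0) = q 0 - P.v * q 1) (hy₁ : δ (y 1) = P.u * q 1)
    (hz₀ : δ (z 0) = r 0 - P.v * r 1) (hz₁ : δ (z 1) = P.u * r 1) :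
    ∑ s, (pT δ P.b y s * rE δ (P.v * P.i) P.i p r s
        - rX δ (P.v * P.i) P.i q s * δ (pE δ (P.db s) x z))
      + ∑ s, (pT δ P.b z s * rE δ (P.v * P.i) P.i q p s
        - rX δ (P.v * P.i) P.i r s * δ (pE δ (P.db s) y x))
      + ∑ s, (pT δ P.b x s * rE δ (P.v * P.i) P.i r q s
        - rX δ (P.v * P.i) P.i p s * δ (pE δ (P.db s) z y)) = 0 := by
  simp only [pT, pE, rE, rX, rS, Derivation.leibniz, smul_eq_mul,
    P.der_b δ P.der_g P.der_c₁ P.der_c₂ P.der_c₃]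
  simp only [db, b, w, Fin.sum_univ_two, Matrix.cons_val_zero, Matrix.cons_val_one,
    hx₀, hx₁, hy₀, hy₁, hz₀, hz₁, Derivation.leibniz, Derivation.leibniz_pow, map_add, map_sub,
    map_neg, smul_eq_mul, P.der_i δ, P.der_g, P.der_c₁, P.der_c₂, P.der_c₃,
    derivation_two, Derivation.map_one_eq_zero, nsmul_eq_mul, Nat.cast_ofNat]
  -- Again the cofactor of the relation u i = 1.
  linear_combination (
   p 0 * δ (q 0) * r 1 * P.i * P.c₃ + p 0 * δ (q 0) * r 1 * P.i * P.c₃ * P.v^2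
      - p 0 * δ (r 0) * q 1 * P.i * P.c₃ - p 0 * δ (r 0) * q 1 * P.i * P.c₃ * P.v^2
      - 2 * p 0 * q 1 * δ (r 1) * P.g * P.i * P.c₃ - 2 * p 0 * q 1 * δ (r 1) * P.i * P.c₃ * P.v
      + 2 * p 0 * δ (q 1) * r 1 * P.g * P.i * P.c₃ + 2 * p 0 * δ (q 1) * r 1 * P.i * P.c₃ * P.v
      - δ (p 0) * q 0 * r 1 * P.i * P.c₃ - δ (p 0) * q 0 * r 1 * P.i * P.c₃ * P.v^2
      + δ (p 0) * r 0 * q 1 * P.i * P.c₃ + δ (p 0) * r 0 * q 1 * P.i * P.c₃ * P.v^2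
      - 2 * δ (p 0) * q 1 * P.g * P.i * P.c₁ * (δ P.v) * z 1
      - 2 * δ (p 0) * q 1 * P.g * P.i * P.c₃ * (δ P.v) * z 0
      + 2 * δ (p 0) * q 1 * P.g * P.i^2 * P.c₁ * (δ P.u) * P.v * z 1
      + 2 * δ (p 0) * q 1 * P.g * P.i^2 * P.c₃ * (δ P.u) * P.v * z 0
      - 2 * δ (p 0) * q 1 * P.i^2 * P.c₁ * (δ P.u) * z 1
      - 2 * δ (p 0) * q 1 * P.i^2 * P.c₃ * (δ P.u) * z 0
      + δ (p 0) * δ (q 1) * P.i * P.c₁ * P.v^2 * z 1 + δ (p 0) * δ (q 1) * P.i * P.c₁ * z 1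
      + δ (p 0) * δ (q 1) * P.i * P.c₃ * P.v^2 * z 0 + δ (p 0) * δ (q 1) * P.i * P.c₃ * z 0
      - δ (p 0) * δ (q 1) * P.c₁ * P.v * z 0 + δ (p 0) * δ (q 1) * P.c₂ * P.v * z 1
      + 2 * δ (p 0) * r 1 * P.g * P.i * P.c₁ * (δ P.v) * y 1
      + 2 * δ (p 0) * r 1 * P.g * P.i * P.c₃ * (δ P.v) * y 0
      - 2 * δ (p 0) * r 1 * P.g * P.i^2 * P.c₁ * (δ P.u) * P.v * y 1
      - 2 * δ (p 0) * r 1 * P.g * P.i^2 * P.c₃ * (δ P.u) * P.v * y 0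
      + 2 * δ (p 0) * r 1 * P.i^2 * P.c₁ * (δ P.u) * y 1
      + 2 * δ (p 0) * r 1 * P.i^2 * P.c₃ * (δ P.u) * y 0
      - δ (p 0) * δ (r 1) * P.i * P.c₁ * P.v^2 * y 1 - δ (p 0) * δ (r 1) * P.i * P.c₁ * y 1
      - δ (p 0) * δ (r 1) * P.i * P.c₃ * P.v^2 * y 0 - δ (p 0) * δ (r 1) * P.i * P.c₃ * y 0
      + δ (p 0) * δ (r 1) * P.c₁ * P.v * y 0 - δ (p 0) * δ (r 1) * P.c₂ * P.v * y 1
      + q 0 * δ (r 0) * p 1 * P.i * P.c₃ + q 0 * δ (r 0) * p 1 * P.i * P.c₃ * P.v^2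
      + 2 * q 0 * p 1 * δ (r 1) * P.g * P.i * P.c₃ + 2 * q 0 * p 1 * δ (r 1) * P.i * P.c₃ * P.v
      - 2 * q 0 * δ (p 1) * r 1 * P.g * P.i * P.c₃ - 2 * q 0 * δ (p 1) * r 1 * P.i * P.c₃ * P.v
      - δ (q 0) * r 0 * p 1 * P.i * P.c₃ - δ (q 0) * r 0 * p 1 * P.i * P.c₃ * P.v^2
      + 2 * δ (q 0) * p 1 * P.g * P.i * P.c₁ * (δ P.v) * z 1
      + 2 * δ (q 0) * p 1 * P.g * P.i * P.c₃ * (δ P.v) * z 0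
      - 2 * δ (q 0) * p 1 * P.g * P.i^2 * P.c₁ * (δ P.u) * P.v * z 1
      - 2 * δ (q 0) * p 1 * P.g * P.i^2 * P.c₃ * (δ P.u) * P.v * z 0
      + 2 * δ (q 0) * p 1 * P.i^2 * P.c₁ * (δ P.u) * z 1
      + 2 * δ (q 0) * p 1 * P.i^2 * P.c₃ * (δ P.u) * z 0
      - δ (q 0) * δ (p 1) * P.i * P.c₁ * P.v^2 * z 1 - δ (q 0) * δ (p 1) * P.i * P.c₁ * z 1
      - δ (q 0) * δ (p 1) * P.i * P.c₃ * P.v^2 * z 0 - δ (q 0) * δ (p 1) * P.i * P.c₃ * z 0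
      + δ (q 0) * δ (p 1) * P.c₁ * P.v * z 0 - δ (q 0) * δ (p 1) * P.c₂ * P.v * z 1
      - 2 * δ (q 0) * r 1 * P.g * P.i * P.c₁ * (δ P.v) * x 1
      - 2 * δ (q 0) * r 1 * P.g * P.i * P.c₃ * (δ P.v) * x 0
      + 2 * δ (q 0) * r 1 * P.g * P.i^2 * P.c₁ * (δ P.u) * P.v * x 1
      + 2 * δ (q 0) * r 1 * P.g * P.i^2 * P.c₃ * (δ P.u) * P.v * x 0
      - 2 * δ (q 0) * r 1 * P.i^2 * P.c₁ * (δ P.u) * x 1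
      - 2 * δ (q 0) * r 1 * P.i^2 * P.c₃ * (δ P.u) * x 0
      + δ (q 0) * δ (r 1) * P.i * P.c₁ * P.v^2 * x 1 + δ (q 0) * δ (r 1) * P.i * P.c₁ * x 1
      + δ (q 0) * δ (r 1) * P.i * P.c₃ * P.v^2 * x 0 + δ (q 0) * δ (r 1) * P.i * P.c₃ * x 0
      - δ (q 0) * δ (r 1) * P.c₁ * P.v * x 0 + δ (q 0) * δ (r 1) * P.c₂ * P.v * x 1
      - 2 * r 0 * p 1 * δ (q 1) * P.g * P.i * P.c₃ - 2 * r 0 * p 1 * δ (q 1) * P.i * P.c₃ * P.v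
      + 2 * r 0 * δ (p 1) * q 1 * P.g * P.i * P.c₃ + 2 * r 0 * δ (p 1) * q 1 * P.i * P.c₃ * P.v
      - 2 * δ (r 0) * p 1 * P.g * P.i * P.c₁ * (δ P.v) * y 1
      - 2 * δ (r 0) * p 1 * P.g * P.i * P.c₃ * (δ P.v) * y 0
      + 2 * δ (r 0) * p 1 * P.g * P.i^2 * P.c₁ * (δ P.u) * P.v * y 1
      + 2 * δ (r 0) * p 1 * P.g * P.i^2 * P.c₃ * (δ P.u) * P.v * y 0
      - 2 * δ (r 0) * p 1 * P.i^2 * P.c₁ * (δ P.u) * y 1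
      - 2 * δ (r 0) * p 1 * P.i^2 * P.c₃ * (δ P.u) * y 0
      + δ (r 0) * δ (p 1) * P.i * P.c₁ * P.v^2 * y 1 + δ (r 0) * δ (p 1) * P.i * P.c₁ * y 1
      + δ (r 0) * δ (p 1) * P.i * P.c₃ * P.v^2 * y 0 + δ (r 0) * δ (p 1) * P.i * P.c₃ * y 0
      - δ (r 0) * δ (p 1) * P.c₁ * P.v * y 0 + δ (r 0) * δ (p 1) * P.c₂ * P.v * y 1
      + 2 * δ (r 0) * q 1 * P.g * P.i * P.c₁ * (δ P.v) * x 1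
      + 2 * δ (r 0) * q 1 * P.g * P.i * P.c₃ * (δ P.v) * x 0
      - 2 * δ (r 0) * q 1 * P.g * P.i^2 * P.c₁ * (δ P.u) * P.v * x 1
      - 2 * δ (r 0) * q 1 * P.g * P.i^2 * P.c₃ * (δ P.u) * P.v * x 0
      + 2 * δ (r 0) * q 1 * P.i^2 * P.c₁ * (δ P.u) * x 1
      + 2 * δ (r 0) * q 1 * P.i^2 * P.c₃ * (δ P.u) * x 0
      - δ (r 0) * δ (q 1) * P.i * P.c₁ * P.v^2 * x 1 - δ (r 0) * δ (q 1) * P.i * P.c₁ * x 1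
      - δ (r 0) * δ (q 1) * P.i * P.c₃ * P.v^2 * x 0 - δ (r 0) * δ (q 1) * P.i * P.c₃ * x 0
      + δ (r 0) * δ (q 1) * P.c₁ * P.v * x 0 - δ (r 0) * δ (q 1) * P.c₂ * P.v * x 1
      + 2 * p 1 * δ (q 1) * P.g * P.i^2 * P.c₁ * (δ P.u) * z 1
      + 2 * p 1 * δ (q 1) * P.g * P.i^2 * P.c₃ * (δ P.u) * z 0
      - 2 * p 1 * δ (q 1) * P.i * P.c₁ * (δ P.v) * z 1
      - 2 * p 1 * δ (q 1) * P.i * P.c₃ * (δ P.v) * z 0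
      + 2 * p 1 * δ (q 1) * P.i^2 * P.c₁ * (δ P.u) * P.v * z 1
      + 2 * p 1 * δ (q 1) * P.i^2 * P.c₃ * (δ P.u) * P.v * z 0
      - 2 * p 1 * δ (r 1) * P.g * P.i^2 * P.c₁ * (δ P.u) * y 1
      - 2 * p 1 * δ (r 1) * P.g * P.i^2 * P.c₃ * (δ P.u) * y 0
      + 2 * p 1 * δ (r 1) * P.i * P.c₁ * (δ P.v) * y 1
      + 2 * p 1 * δ (r 1) * P.i * P.c₃ * (δ P.v) * y 0
      - 2 * p 1 * δ (r 1) * P.i^2 * P.c₁ * (δ P.u) * P.v * y 1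
      - 2 * p 1 * δ (r 1) * P.i^2 * P.c₃ * (δ P.u) * P.v * y 0
      - 2 * δ (p 1) * q 1 * P.g * P.i^2 * P.c₁ * (δ P.u) * z 1
      - 2 * δ (p 1) * q 1 * P.g * P.i^2 * P.c₃ * (δ P.u) * z 0
      + 2 * δ (p 1) * q 1 * P.i * P.c₁ * (δ P.v) * z 1
      + 2 * δ (p 1) * q 1 * P.i * P.c₃ * (δ P.v) * z 0
      - 2 * δ (p 1) * q 1 * P.i^2 * P.c₁ * (δ P.u) * P.v * z 1
      - 2 * δ (p 1) * q 1 * P.i^2 * P.c₃ * (δ P.u) * P.v * z 0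
      + 2 * δ (p 1) * r 1 * P.g * P.i^2 * P.c₁ * (δ P.u) * y 1
      + 2 * δ (p 1) * r 1 * P.g * P.i^2 * P.c₃ * (δ P.u) * y 0
      - 2 * δ (p 1) * r 1 * P.i * P.c₁ * (δ P.v) * y 1
      - 2 * δ (p 1) * r 1 * P.i * P.c₃ * (δ P.v) * y 0
      + 2 * δ (p 1) * r 1 * P.i^2 * P.c₁ * (δ P.u) * P.v * y 1
      + 2 * δ (p 1) * r 1 * P.i^2 * P.c₃ * (δ P.u) * P.v * y 0
      + 2 * q 1 * δ (r 1) * P.g * P.i^2 * P.c₁ * (δ P.u) * x 1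
      + 2 * q 1 * δ (r 1) * P.g * P.i^2 * P.c₃ * (δ P.u) * x 0
      - 2 * q 1 * δ (r 1) * P.i * P.c₁ * (δ P.v) * x 1
      - 2 * q 1 * δ (r 1) * P.i * P.c₃ * (δ P.v) * x 0
      + 2 * q 1 * δ (r 1) * P.i^2 * P.c₁ * (δ P.u) * P.v * x 1
      + 2 * q 1 * δ (r 1) * P.i^2 * P.c₃ * (δ P.u) * P.v * x 0
      - 2 * δ (q 1) * r 1 * P.g * P.i^2 * P.c₁ * (δ P.u) * x 1
      - 2 * δ (q 1) * r 1 * P.g * P.i^2 * P.c₃ * (δ P.u) * x 0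
      + 2 * δ (q 1) * r 1 * P.i * P.c₁ * (δ P.v) * x 1
      + 2 * δ (q 1) * r 1 * P.i * P.c₃ * (δ P.v) * x 0
      - 2 * δ (q 1) * r 1 * P.i^2 * P.c₁ * (δ P.u) * P.v * x 1
      - 2 * δ (q 1) * r 1 * P.i^2 * P.c₃ * (δ P.u) * P.v * x 0) * P.u_mul_i

/-- Puts the linearization of P + λR in the form ∑ φ^s E_s(x,z) plus total derivatives. The two
potentials are kept apart because the second carries the factor λ. -/
theorem pairing_linearization (lam : R) (ε : Derivation ℝ R R) {φ : Fin 2 → R}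
    (hu : ε P.u = φ 0) (hv : ε P.v = φ 1) (hg : ε P.g = 0) (h₁ : ε P.c₁ = 0) (h₂ : ε P.c₂ = 0)
    (h₃ : ε P.c₃ = 0) (x z : Fin 2 → R) :
    ∃ q : R × R, ∑ i, z i * (pT δ (fun i j => ε (P.b i j)) x i
        + lam * δ (rV δ (P.v * P.i) P.i (ε (P.v * P.i)) (ε P.i) x i))
      = ∑ s, φ s * (pE δ (P.db s) x z + lam * rE δ (P.v * P.i) P.i
          (rP δ (P.v * P.i) P.i x) (rP δ (P.v * P.i) P.i z) s) + (δ q.1 + lam * δ q.2) := by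
  refine ⟨(∑ i, ∑ j, z i * ε (P.b i j) * x j,
    ∑ i, z i * rV δ (P.v * P.i) P.i (ε (P.v * P.i)) (ε P.i) x i
      - (rP δ (P.v * P.i) P.i z 0 * ε (P.v * P.i) + rP δ (P.v * P.i) P.i z 1 * ε P.i)
        * δ (x 1)), ?_⟩
  have e₁ := pairing_pT δ (fun i j => ε (P.b i j)) x z
  have e₂ := pairing_rV δ (P.v * P.i) P.i (ε (P.v * P.i)) (ε P.i) x z
  have e₃ : pE δ (fun i j => ε (P.b i j)) x z
      = φ 0 * pE δ (P.db 0) x z + φ 1 * pE δ (P.db 1) x z := by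
    simp only [P.der_b ε hg h₁ h₂ h₃, hu, hv, pE, Fin.sum_univ_two]
    ring
  have e₄ : ε (P.v * P.i) = P.i * φ 1 - P.v * (P.i ^ 2 * φ 0) := by
    rw [Derivation.leibniz, P.der_i, hu, hv, smul_eq_mul, smul_eq_mul]
    ring
  have e₅ : ε P.i = -(P.i ^ 2 * φ 0) := by rw [P.der_i, hu]
  -- Inserts δι = -ι² δu and δa = ι δv - vι² δu. In each term one factor ι joins Dx₂ or Dz₂ to form
  -- the second component of WᵀDx or WᵀDz, which turns the expression into `rE`.
  have e₆ : ε (P.v * P.i) * (δ (x 1) * δ (rP δ (P.v * P.i) P.i z 0)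
        - δ (z 1) * δ (rP δ (P.v * P.i) P.i x 0))
      + ε P.i * (δ (x 1) * δ (rP δ (P.v * P.i) P.i z 1)
        - δ (z 1) * δ (rP δ (P.v * P.i) P.i x 1))
      = ∑ s, φ s * rE δ (P.v * P.i) P.i
          (rP δ (P.v * P.i) P.i x) (rP δ (P.v * P.i) P.i z) s := by
    have hx : rP δ (P.v * P.i) P.i x 1 = P.i * δ (x 1) := rfl
    have hz : rP δ (P.v * P.i) P.i z 1 = P.i * δ (z 1) := rfl
    rw [e₄, e₅]
    simp only [rE, rS, Fin.sum_univ_two, Matrix.cons_val_zero, Matrix.cons_val_one]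
    -- Derivatives of the second components are made opaque, so that only undifferentiated
    -- occurrences are unfolded.
    generalize δ (rP δ (P.v * P.i) P.i z 1) = t₁
    generalize δ (rP δ (P.v * P.i) P.i x 1) = t₂
    rw [hx, hz]
    ring
  simp only [mul_add, Finset.sum_add_distrib, mul_left_comm _ lam, ← Finset.mul_sum]
  rw [e₁, e₂, e₃, e₆]
  simp only [Fin.sum_univ_two]
  ring

/-- Expands ∑ (T y)^s E_s(x,z) with T = P + λR and E = `pE` + λ `rE` into the PP, PR and RR parts.
-/
theorem jacobi {lam : R} (hlam : δ lam = 0) (ε : (Fin 2 → R) → Derivation ℝ R R)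
    (hu : ∀ φ, ε φ P.u = φ 0) (hv : ∀ φ, ε φ P.v = φ 1) (hg : ∀ φ, ε φ P.g = 0)
    (h₁ : ∀ φ, ε φ P.c₁ = 0) (h₂ : ∀ φ, ε φ P.c₂ = 0) (h₃ : ∀ φ, ε φ P.c₃ = 0)
    {T : (Fin 2 → R) → Fin 2 → R} {L : (Fin 2 → R) → (Fin 2 → R) → Fin 2 → R}
    (hT : ∀ x i, T x i = pT δ P.b x i + lam * rT δ (P.v * P.i) P.i x i)
    (hL : ∀ φ x i, L φ x i = pT δ (fun i j => ε φ (P.b i j)) x i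
      + lam * δ (rV δ (P.v * P.i) P.i (ε φ (P.v * P.i)) (ε φ P.i) x i))
    (x y z : Fin 2 → R) :
    ∃ q, ∑ i, z i * L (T y) x i + ∑ i, x i * L (T z) y i + ∑ i, y i * L (T x) z i = δ q := by
  have hp : ∀ x : Fin 2 → R, δ (x 1) = P.u * rP δ (P.v * P.i) P.i x 1 := fun x => by
    change _ = P.u * (P.i * δ (x 1))
    linear_combination -δ (x 1) * P.u_mul_i
  have hp' : ∀ x : Fin 2 → R, δ (x 0) = rP δ (P.v * P.i) P.i x 0
      - P.v * rP δ (P.v * P.i) P.i x 1 := fun x => by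
    change _ = δ (x 0) + P.v * P.i * δ (x 1) - P.v * (P.i * δ (x 1))
    ring
  have key := fun φ => P.pairing_linearization lam (ε φ) (hu φ) (hv φ) (hg φ) (h₁ φ) (h₂ φ) (h₃ φ)
  obtain ⟨q₁, e₁⟩ := key (T y) x z
  obtain ⟨q₂, e₂⟩ := key (T z) y x
  obtain ⟨q₃, e₃⟩ := key (T x) z y
  have hPP := P.cyclic_pE x y z
  have hPR := P.cyclic_pE_rE (hp' x) (hp x) (hp' y) (hp y) (hp' z) (hp z)
  have hRR := cyclic_rE δ (P.v * P.i) P.i (rP δ (P.v * P.i) P.i x) (rP δ (P.v * P.i) P.i y)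
    (rP δ (P.v * P.i) P.i z)
  simp only [hL, e₁, e₂, e₃]
  simp only [hT, rT]
  -- The potential collects, in order, the boundary terms of the three linearizations, those of
  -- moving the outer D of R onto `pE`, and the λ² term from `cyclic_rE`.
  refine ⟨q₁.1 + lam * q₁.2 + (q₂.1 + lam * q₂.2) + (q₃.1 + lam * q₃.2)
    + lam * (∑ s, (rX δ (P.v * P.i) P.i (rP δ (P.v * P.i) P.i y) s * pE δ (P.db s) x z
      + rX δ (P.v * P.i) P.i (rP δ (P.v * P.i) P.i z) s * pE δ (P.db s) y x
      + rX δ (P.v * P.i) P.i (rP δ (P.v * P.i) P.i x) s * pE δ (P.db s) z y))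
    + lam * (lam * (P.i * (δ (rP δ (P.v * P.i) P.i y 1)
        * rS δ 0 (rP δ (P.v * P.i) P.i x) (rP δ (P.v * P.i) P.i z)
      + δ (rP δ (P.v * P.i) P.i z 1)
        * rS δ 0 (rP δ (P.v * P.i) P.i y) (rP δ (P.v * P.i) P.i x)
      + δ (rP δ (P.v * P.i) P.i x 1)
        * rS δ 0 (rP δ (P.v * P.i) P.i z) (rP δ (P.v * P.i) P.i y)))), ?_⟩
  rw [map_add, map_add, Derivation.leibniz δ lam (lam * _), Derivation.leibniz δ lam (P.i * _),
    ← hRR]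
  simp only [Fin.sum_univ_two, map_add, Derivation.leibniz, hlam, smul_eq_mul, mul_zero,
    add_zero] at hPP hPR ⊢
  linear_combination hPP + lam * hPR

theorem skew {lam : R} (hlam : δ lam = 0) {T : (Fin 2 → R) → Fin 2 → R}
    (hT : ∀ x i, T x i = pT δ P.b x i + lam * rT δ (P.v * P.i) P.i x i) (x y : Fin 2 → R) :
    ∃ q, ∑ i, x i * T y i + ∑ i, y i * T x i = δ q := by
  obtain ⟨q₁, e₁⟩ : ∃ q, ∑ i, x i * pT δ P.b y i + ∑ i, y i * pT δ P.b x i = δ q :=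
    ⟨_, pT_skew δ P.b x y⟩
  obtain ⟨q₂, e₂⟩ : ∃ q, ∑ i, x i * rT δ (P.v * P.i) P.i y i
      + ∑ i, y i * rT δ (P.v * P.i) P.i x i = δ q :=
    ⟨_, rT_skew δ (P.v * P.i) P.i x y⟩
  refine ⟨q₁ + lam * q₂, ?_⟩
  rw [map_add, Derivation.leibniz, hlam, smul_zero, add_zero, smul_eq_mul, ← e₁, ← e₂]
  simp only [hT, Fin.sum_univ_two]
  ring

end Pencil

end Identities

/-! ### Matrix operators, evaluation at jets, and Christoffel symbols -/

section MatSem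

variable {n : ℕ} {U : Opens (Fin n → ℝ)}

theorem OpSem.congr {B : DiffOp n} {T T' : DiffAlg U → DiffAlg U}
    {L L' : (Fin n → DiffAlg U) → DiffAlg U → DiffAlg U} (h : OpSem B T L)
    (hT : ∀ χ, T χ = T' χ) (hL : ∀ φ χ, L φ χ = L' φ χ) : OpSem B T' L' := by
  obtain ⟨b, hb, h₁, h₂⟩ := h
  exact ⟨b, hb, fun χ => (h₁ χ).trans (hT χ), fun φ χ => (h₂ φ χ).trans (hL φ χ)⟩

/-- The matrix operator `A` acts over `U` by `T`, and its linearization is `L`. -/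
def MatSem (A : MatDiffOp n) (T : (Fin n → DiffAlg U) → Fin n → DiffAlg U)
    (L : (Fin n → DiffAlg U) → (Fin n → DiffAlg U) → Fin n → DiffAlg U) : Prop :=
  ∃ (S : Fin n → Fin n → DiffAlg U → DiffAlg U)
    (K : Fin n → Fin n → (Fin n → DiffAlg U) → DiffAlg U → DiffAlg U),
    (∀ i j, OpSem (A i j) (S i j) (K i j)) ∧ (∀ ψ i, ∑ j, S i j (ψ j) = T ψ i) ∧
      ∀ φ ψ i, ∑ j, K i j φ (ψ j) = L φ ψ i

variable {A B : MatDiffOp n} {S T : (Fin n → DiffAlg U) → Fin n → DiffAlg U}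
  {K L : (Fin n → DiffAlg U) → (Fin n → DiffAlg U) → Fin n → DiffAlg U}

theorem MatSem.add_smul (hA : MatSem A S K) (hB : MatSem B T L) (r : ℝ) :
    MatSem (A + r • B) (fun ψ i => S ψ i + r • T ψ i) (fun φ ψ i => K φ ψ i + r • L φ ψ i) := by
  obtain ⟨S', K', h, hS, hK⟩ := hA
  obtain ⟨T', L', h', hT, hL⟩ := hB
  refine ⟨_, _, fun i j => (h i j).add ((h' i j).smul r), fun ψ i => ?_, fun φ ψ i => ?_⟩
  · beta_reduce
    rw [← hS, ← hT, Finset.smul_sum, ← Finset.sum_add_distrib]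
  · beta_reduce
    rw [← hK, ← hL, Finset.smul_sum, ← Finset.sum_add_distrib]

theorem MatSem.repr_apply (h : MatSem A T L) {Ψ : Fin n → JetFun n} {ψ : Fin n → DiffAlg U}
    (hΨ : ∀ i, Repr (Ψ i) (ψ i)) (i : Fin n) : Repr (A.apply Ψ i) (T ψ i) := by
  obtain ⟨S', K', h, hS, -⟩ := h
  rw [← hS]
  exact HydroJet.repr_apply h hΨ i

theorem MatSem.isHamiltonian (h : MatSem A T L)
    (skew : ∀ ψ φ : Fin n → DiffAlg U, ∃ q, ∑ i, ψ i * T φ i + ∑ i, φ i * T ψ i = D q)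
    (jacobi : ∀ x y z : Fin n → DiffAlg U,
      ∃ q, ∑ i, z i * L (T y) x i + ∑ i, x i * L (T z) y i + ∑ i, y i * L (T x) z i = D q) :
    IsHamiltonian (U : Set (Fin n → ℝ)) A := by
  obtain ⟨S', K', h, hS, hK⟩ := h
  refine isHamiltonian_of_opSem h ?_ ?_
  · simpa only [hS] using skew
  · simpa only [hS, hK] using jacobi

/-- The value of a differential function at a point. -/
def evalAt (p : JetDom U) : DiffAlg U →+* ℝ where
  toFun a := a.1 p
  map_one' := rfl
  map_zero' := rfl
  map_add' _ _ := rfl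
  map_mul' _ _ := rfl

theorem repr_iff {F : JetFun n} {a : DiffAlg U} :
    Repr F a ↔ ∀ x (J : Jet n) (h : J 0 ∈ U), F x J = evalAt ⟨(x, J), h⟩ a := Iff.rfl

theorem evalAt_algebraMap (p : JetDom U) (r : ℝ) :
    evalAt p (algebraMap ℝ (DiffAlg U) r) = r := rfl

theorem evalAt_coord (p : JetDom U) (σ : ℕ) (i : Fin n) :
    evalAt p (coord U σ i) = p.1.2 σ i := rfl

theorem jetPartial_ofField_zero (i : Fin n) (f : (Fin n → ℝ) → ℝ) :
    jetPartial 0 i (ofField f) = ofField (fieldPartial i f) := by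
  funext x J
  simp [jetPartial, ofField, fieldPartial]

theorem jetPartial_ofField {σ : ℕ} (hσ : σ ≠ 0) (i : Fin n) (f : (Fin n → ℝ) → ℝ) :
    jetPartial σ i (ofField f) = 0 := by
  funext x J
  simp [jetPartial, ofField, Function.update_of_ne hσ.symm]

theorem totalD_ofField (f : (Fin n → ℝ) → ℝ) (x : ℝ) (J : Jet n) :
    totalD (ofField f) x J = ∑ k, J 1 k * fieldPartial k f (J 0) := by
  rw [totalD, finsum_eq_single _ 0]
  · simp only [jetPartial_ofField_zero]
    simp [ofField]
  · intro σ hσ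
    simp [jetPartial_ofField hσ]

theorem varDeriv_ofField (f : (Fin n → ℝ) → ℝ) (i : Fin n) :
    varDeriv (ofField f) i = ofField (fieldPartial i f) := by
  funext x J
  rw [varDeriv, finsum_eq_single _ 0]
  · simp [jetPartial_ofField_zero]
  · intro σ hσ
    simp [jetPartial_ofField hσ, iterate_totalD_zero]

theorem fieldPartial_eq {f : (Fin n → ℝ) → ℝ} {k : Fin n} {u : Fin n → ℝ} {d : ℝ}
    (h : HasDerivAt (fun s => f (Function.update u k s)) d (u k)) : fieldPartial k f u = d :=
  h.deriv

/-- Multiplying by the invertible matrix g determines the symbols, so a candidate can be checked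
without computing g⁻¹. -/
theorem christoffel_eq {g : (Fin n → ℝ) → Matrix (Fin n) (Fin n) ℝ} {u : Fin n → ℝ}
    (hg : (g u).det ≠ 0) {i j : Fin n} {Γ : Fin n → ℝ}
    (h : ∀ l, (1 / 2) * ∑ s : Fin n, (g u i s * fieldPartial s (fun w => g w j l) u
      + g u l s * fieldPartial s (fun w => g w i j) u
      - g u j s * fieldPartial s (fun w => g w i l) u) = ∑ s, g u l s * Γ s) (k : Fin n) :
    christoffel g i j k u = Γ k := by
  have h' : christoffel g i j k u = ((g u)⁻¹.mulVec ((g u).mulVec Γ)) k := by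
    simp only [christoffel, h]
    rfl
  rw [h', Matrix.mulVec_mulVec, Matrix.nonsing_inv_mul _ (isUnit_iff_ne_zero.2 hg),
    Matrix.one_mulVec]

end MatSem

/-- If g = b + bᵀ and Γ^{ij}_k u^k_x = D b^{ij}, then (b^{ij} + b^{ji}) D + (D b^{ij}) regroups as
b^{ji} D + D∘b^{ij}. -/
theorem matSem_firstOrderOp {U : Opens (Fin 2 → ℝ)}
    {g : (Fin 2 → ℝ) → Matrix (Fin 2) (Fin 2) ℝ} {b : Fin 2 → Fin 2 → DiffAlg U}
    (hg : ∀ i j, Repr (ofField fun u => g u i j) (b i j + b j i))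
    (hΓ : ∀ i j, Repr (fun _ J => ∑ k, christoffel g i j k (J 0) * J 1 k) (D (b i j))) :
    MatSem (firstOrderOp g) (pT D b) (fun φ => pT D fun i j => ev φ (b i j)) := by
  refine ⟨_, _, fun i j => ((opSem_opMul (hg i j)).comp opSem_opD).add (opSem_opMul (hΓ i j)),
    fun ψ i => ?_, fun φ ψ i => ?_⟩
  · simp only [pT, Fin.sum_univ_two, Derivation.leibniz, smul_eq_mul]
    ring
  · simp only [pT, Fin.sum_univ_two, Derivation.leibniz, smul_eq_mul, map_add, ev_D]
    ring

/-! ### Factorization of the third-order operator -/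

section ThirdOrder

variable {U : Opens (Fin 2 → ℝ)} {a ι h : DiffAlg U}

/-- The inner matrix is W D Wᵀ: its last entry is a D a + ι D ι, which equals β D + D β for β = (a²
+ ι²)/2. The element `h` plays the role of 1/2. -/
theorem matSem_thirdOrderOp (ha : Repr (ofField fun u => u 1 / u 0) a)
    (hb : Repr (ofField fun u => (u 1 ^ 2 + 1) / (2 * u 0 ^ 2)) (h * (a ^ 2 + ι ^ 2)))
    (hh : 2 * h = 1) (hd : ∀ ε : Derivation ℝ (DiffAlg U) (DiffAlg U), ε h = 0) :
    MatSem thirdOrderOp (rT D a ι) (fun φ x i => D (rV D a ι (ev φ a) (ev φ ι) x i)) := by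
  let β := h * (a ^ 2 + ι ^ 2)
  let β' : (Fin 2 → DiffAlg U) → DiffAlg U := fun φ => a * ev φ a + ι * ev φ ι
  have hdβ : ∀ ε : Derivation ℝ (DiffAlg U) (DiffAlg U), ε β = a * ε a + ι * ε ι := fun ε => by
    simp only [β, Derivation.leibniz, Derivation.leibniz_pow, map_add, hd, smul_eq_mul,
      nsmul_eq_mul, Nat.cast_ofNat]
    linear_combination (a * ε a + ι * ε ι) * hh
  let S : Fin 2 → Fin 2 → DiffAlg U → DiffAlg U :=
    ![![fun χ => D χ, fun χ => D (a * χ)],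
      ![fun χ => a * D χ, fun χ => β * D χ + D (β * χ)]]
  let K : Fin 2 → Fin 2 → (Fin 2 → DiffAlg U) → DiffAlg U → DiffAlg U :=
    ![![fun _ _ => 0, fun φ χ => D (ev φ a * χ)],
      ![fun φ χ => ev φ a * D χ, fun φ χ => β' φ * D χ + D (β' φ * χ)]]
  have hin : ∀ i j, OpSem (innerOp i j) (S i j) (K i j) := by
    have A := opSem_opMul ha
    have B := opSem_opMul hb
    have O := opSem_opD (U := U)
    intro i j
    fin_cases i <;> fin_cases j
    · exact O
    · exact (O.comp A).congr (fun χ => rfl) fun φ χ => by simp [K]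
    · exact (A.comp O).congr (fun χ => rfl) fun φ χ => by simp [K]
    · exact ((B.comp O).add (O.comp B)).congr (fun χ => rfl) fun φ χ => by
        have := hdβ (ev φ)
        simp only [β] at this
        simp [K, β', this]
  refine ⟨_, _, fun i j => opSem_opD.comp ((hin i j).comp opSem_opD), fun x i => ?_,
    fun φ x i => ?_⟩
  · fin_cases i
    · simp [S, rT, rX, rP]
    · have e : β = h * (a ^ 2 + ι ^ 2) := rfl
      have e₂ := hdβ D
      simp only [S, rT, rX, rP, Fin.sum_univ_two, Fin.mk_one,
        Matrix.cons_val_zero, Matrix.cons_val_one, ← map_add]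
      refine congrArg D ?_
      simp only [Derivation.leibniz, smul_eq_mul, map_add, e₂]
      rw [e]
      linear_combination ((a ^ 2 + ι ^ 2) * D (D (x 1))) * hh
  · fin_cases i
    · simp [K, S, rV]
    · simp only [K, S, β', rV, rP, Fin.sum_univ_two, Fin.mk_one,
        Matrix.cons_val_zero, Matrix.cons_val_one, ← map_add, mul_zero, map_zero, add_zero,
        zero_add]
      refine congrArg D ?_
      simp only [Derivation.leibniz, smul_eq_mul, map_add]
      ring

end ThirdOrder

/-! ### Gradient Christoffel symbols of the three metrics -/

section Potentials

variable (γ : ℝ) (c : Fin 3 → ℝ)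

/-- The potentials `b^{ij}` of the Christoffel symbols of the pencil of metrics. -/
def potential : Fin 2 → Fin 2 → (Fin 2 → ℝ) → ℝ :=
  ![![fun u => c 2 * (u 1 + γ / 2) - c 0 * u 0, fun u => c 0 * u 1 + c 1 * u 0],
    ![fun u => c 2 * flux γ 1 u - c 0 * u 1, fun u => c 0 * flux γ 1 u + c 1 * (u 1 + γ / 2)]]

/-- The partial derivatives of `potential`. -/
def dPotential (u : Fin 2 → ℝ) : Fin 2 → Fin 2 → Fin 2 → ℝ :=
  ![![![-c 0, c 1], ![-(c 2 * (flux γ 1 u / u 0)), -(c 0 * (flux γ 1 u / u 0))]],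
    ![![c 2, c 0], ![c 2 * ((2 * u 1 + γ) / u 0) - c 0, c 0 * ((2 * u 1 + γ) / u 0) + c 1]]]

/-- The coefficients of the three metrics in the pencil. -/
def coeffs : Fin 3 → Fin 3 → ℝ := ![![1 / 2, 0, 0], ![0, 1, 0], ![0, 0, 1]]

/-- Symmetrization doubles the diagonal entries belonging to the first metric, which accounts for
its coefficient 1/2 in `coeffs`. -/
theorem metric_eq (a : Fin 3) (u : Fin 2 → ℝ) (i j : Fin 2) :
    metric γ a u i j = potential γ (coeffs a) i j u + potential γ (coeffs a) j i u := by
  have h₀ : metric γ 0 u = !![-u 0, 0; 0, flux γ 1 u] := rfl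
  have h₁ : metric γ 1 u = !![0, u 0; u 0, 2 * u 1 + γ] := rfl
  have h₂ : metric γ 2 u = !![2 * u 1 + γ, flux γ 1 u; flux γ 1 u, 0] := rfl
  fin_cases a
  · refine (congrFun (congrFun h₀ i) j).trans ?_
    fin_cases i <;> fin_cases j <;>
      (simp [potential, coeffs]; try ring)
  · refine (congrFun (congrFun h₁ i) j).trans ?_
    fin_cases i <;> fin_cases j <;>
      (simp [potential, coeffs]; try ring)
  · refine (congrFun (congrFun h₂ i) j).trans ?_
    fin_cases i <;> fin_cases j <;>
      (simp [potential, coeffs]; try ring)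

theorem hasDerivAt_flux {u : Fin 2 → ℝ} (hu : u 0 ≠ 0) (k : Fin 2) :
    HasDerivAt (fun s => flux γ 1 (Function.update u k s))
      ((![-(flux γ 1 u / u 0), (2 * u 1 + γ) / u 0] : Fin 2 → ℝ) k) (u k) := by
  fin_cases k
  · have h := ((hasDerivAt_id (u 0)).inv hu).const_mul (u 1 ^ 2 + γ * u 1 - 1)
    simp only [flux, Function.update, Matrix.cons_val_one, Matrix.cons_val_zero]
    refine (h.congr_deriv ?_).congr_of_eventuallyEq (Filter.Eventually.of_forall fun s => ?_)
    · simp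
      field_simp
    · simp [div_eq_mul_inv]
  · have h := (((((hasDerivAt_id (u 1)).pow 2).add
      ((hasDerivAt_id (u 1)).const_mul γ)).sub_const 1).div_const (u 0))
    refine (h.congr_deriv ?_).congr_of_eventuallyEq (Filter.Eventually.of_forall fun s => ?_)
    · simp
    · simp [flux]

theorem hasDerivAt_update (u : Fin 2 → ℝ) (k j : Fin 2) :
    HasDerivAt (fun s => Function.update u k s j) (if j = k then 1 else 0) (u k) := by
  by_cases h : j = k
  · subst h
    simpa using hasDerivAt_id' (u j)
  · simpa [h] using hasDerivAt_const (u k) (u j)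

theorem hasDerivAt_potential {u : Fin 2 → ℝ} (hu : u 0 ≠ 0) (k i j : Fin 2) :
    HasDerivAt (fun s => potential γ c i j (Function.update u k s)) (dPotential γ c u k i j)
      (u k) := by
  have hw := hasDerivAt_flux γ hu k
  have h₀ := hasDerivAt_update u k 0
  have h₁ := hasDerivAt_update u k 1
  have e₁ := ((h₁.add_const (γ / 2)).const_mul (c 2)).sub (h₀.const_mul (c 0))
  have e₂ := (h₁.const_mul (c 0)).add (h₀.const_mul (c 1))
  have e₃ := (hw.const_mul (c 2)).sub (h₁.const_mul (c 0))
  have e₄ := (hw.const_mul (c 0)).add ((h₁.add_const (γ / 2)).const_mul (c 1))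
  fin_cases i <;> fin_cases j
  · refine e₁.congr_deriv ?_
    fin_cases k <;> simp [dPotential]
  · refine e₂.congr_deriv ?_
    fin_cases k <;> simp [dPotential]
  · refine e₃.congr_deriv ?_
    fin_cases k <;> simp [dPotential]
  · refine e₄.congr_deriv ?_
    fin_cases k <;> simp [dPotential]

theorem fieldPartial_metric (a : Fin 3) {u : Fin 2 → ℝ} (hu : u 0 ≠ 0) (k i j : Fin 2) :
    fieldPartial k (fun w => metric γ a w i j) u
      = dPotential γ (coeffs a) u k i j + dPotential γ (coeffs a) u k j i := by
  refine fieldPartial_eq ?_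
  simp only [metric_eq]
  exact (hasDerivAt_potential γ _ hu k i j).add (hasDerivAt_potential γ _ hu k j i)

/-- The gradients of the potentials satisfy the linear equations defining the symbols. Nondegeneracy
enters the argument here, to make that solution unique. -/
theorem christoffel_metric (a : Fin 3) {u : Fin 2 → ℝ} (hu : u 0 ≠ 0)
    (hg : (metric γ a u).det ≠ 0) (i j k : Fin 2) :
    christoffel (metric γ a) i j k u = dPotential γ (coeffs a) u k i j := by
  refine christoffel_eq (Γ := fun k => dPotential γ (coeffs a) u k i j) hg (fun l => ?_) k
  simp only [fieldPartial_metric γ a hu]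
  simp only [metric_eq, Fin.sum_univ_two]
  generalize coeffs a = c
  fin_cases i <;> fin_cases j <;> fin_cases l <;>
    simp [dPotential, potential, flux] <;> field_simp <;> ring

end Potentials

/-! ### Hamiltonian operators and their pencils -/

section Instances

variable {U : Opens (Fin 2 → ℝ)}

theorem exists_inv_repr (hU₀ : ∀ u ∈ U, u 0 ≠ 0)
    : ∃ a : DiffAlg U, Repr (ofField fun u => (u 0)⁻¹) a := by
  refine exists_repr ⟨0, fun p => (p.2 0 0)⁻¹, ?_, fun x J _ => rfl⟩
  refine ContDiffOn.inv ?_ fun p hp => hU₀ _ hp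
  exact ((contDiff_apply_apply ℝ ℝ 0 0).comp contDiff_snd).contDiffOn

/-- The inverse of the first field variable. -/
def invCoord (hU₀ : ∀ u ∈ U, u 0 ≠ 0) : DiffAlg U := (exists_inv_repr hU₀).choose

theorem repr_invCoord (hU₀ : ∀ u ∈ U, u 0 ≠ 0) : Repr (ofField fun u => (u 0)⁻¹) (invCoord hU₀) :=
  (exists_inv_repr hU₀).choose_spec

theorem evalAt_invCoord (hU₀ : ∀ u ∈ U, u 0 ≠ 0)
    (p : JetDom U) : evalAt p (invCoord hU₀) = (p.1.2 0 0)⁻¹ :=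
  (repr_invCoord hU₀ p.1.1 p.1.2 p.2).symm

/-- The data of a pencil over `U`. -/
def pencil (hU₀ : ∀ u ∈ U, u 0 ≠ 0)
    (γ : ℝ) (c : Fin 3 → ℝ) : Pencil (D : Derivation ℝ (DiffAlg U) (DiffAlg U)) where
  u := coord U 0 0
  v := coord U 0 1
  i := invCoord hU₀
  g := algebraMap ℝ _ (γ / 2)
  c₁ := algebraMap ℝ _ (c 0)
  c₂ := algebraMap ℝ _ (c 1)
  c₃ := algebraMap ℝ _ (c 2)
  u_mul_i := by
    refine DiffAlg.ext fun p => ?_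
    change evalAt p (coord U 0 0 * invCoord hU₀) = evalAt p 1
    rw [map_mul, map_one, evalAt_coord, evalAt_invCoord]
    exact mul_inv_cancel₀ (hU₀ _ p.2)
  der_g := D.map_algebraMap _
  der_c₁ := D.map_algebraMap _
  der_c₂ := D.map_algebraMap _
  der_c₃ := D.map_algebraMap _

theorem repr_w (hU₀ : ∀ u ∈ U, u 0 ≠ 0) (γ : ℝ) (c : Fin 3 → ℝ) : Repr (ofField (flux γ 1))
    (pencil hU₀ γ c).w := by
  refine repr_iff.2 fun x J h => ?_
  simp only [ofField, flux, pencil, Pencil.w, map_mul, map_add, map_sub, map_pow, map_one,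
    evalAt_coord, evalAt_algebraMap, evalAt_invCoord, map_ofNat, Matrix.cons_val_one,
    Matrix.cons_val_zero]
  ring

theorem repr_potential (hU₀ : ∀ u ∈ U, u 0 ≠ 0) (γ : ℝ) (c : Fin 3 → ℝ) (i j : Fin 2) :
    Repr (ofField (potential γ c i j)) ((pencil hU₀ γ c).b i j) := by
  refine repr_iff.2 fun x J h => ?_
  have hw : flux γ 1 (J 0) = evalAt ⟨(x, J), h⟩ (pencil hU₀ γ c).w := repr_w hU₀ γ c x J h
  fin_cases i <;> fin_cases j <;>
    simp [ofField, potential, Pencil.b, hw] <;>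
    simp [pencil, evalAt_coord, evalAt_algebraMap]

theorem matSem_firstOrder (hU₀ : ∀ u ∈ U, u 0 ≠ 0) (γ : ℝ)
    (a : Fin 3) (ha : Nondegenerate (U : Set (Fin 2 → ℝ)) (metric γ a)) :
    MatSem (U := U) (firstOrderOp (metric γ a)) (pT D (pencil hU₀ γ (coeffs a)).b)
      (fun φ => pT D fun i j => ev φ ((pencil hU₀ γ (coeffs a)).b i j)) := by
  refine matSem_firstOrderOp (fun i j x J h => ?_) fun i j x J h => ?_
  · refine (metric_eq γ a (J 0) i j).trans ?_
    exact ((repr_potential hU₀ γ (coeffs a) i j).add (repr_potential hU₀ γ (coeffs a) j i)) x J h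
  · have hu : J 0 0 ≠ 0 := hU₀ _ h
    refine Eq.trans ?_ ((repr_potential hU₀ γ (coeffs a) i j).totalD x J h)
    rw [totalD_ofField]
    refine Finset.sum_congr rfl fun k _ => ?_
    rw [christoffel_metric γ a hu (ha _ h), fieldPartial_eq (hasDerivAt_potential γ _ hu k i j),
      mul_comm]

theorem matSem_thirdOrder (hU₀ : ∀ u ∈ U, u 0 ≠ 0) (γ : ℝ) (c : Fin 3 → ℝ) :
    MatSem (U := U) thirdOrderOp
      (rT D ((pencil hU₀ γ c).v * (pencil hU₀ γ c).i) (pencil hU₀ γ c).i)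
      (fun φ x i => D (rV D ((pencil hU₀ γ c).v * (pencil hU₀ γ c).i) (pencil hU₀ γ c).i
        (ev φ ((pencil hU₀ γ c).v * (pencil hU₀ γ c).i)) (ev φ (pencil hU₀ γ c).i) x i)) := by
  refine matSem_thirdOrderOp (h := algebraMap ℝ _ (1 / 2)) ?_ ?_ ?_ fun ε => ε.map_algebraMap _
  · refine repr_iff.2 fun x J h => ?_
    simp [ofField, pencil, evalAt_coord, evalAt_invCoord, div_eq_mul_inv]
  · refine repr_iff.2 fun x J h => ?_
    have hu : J 0 0 ≠ 0 := hU₀ _ h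
    simp only [ofField, pencil, map_mul, map_add, map_pow, evalAt_coord, evalAt_invCoord,
      evalAt_algebraMap]
    field_simp
  · refine DiffAlg.ext fun p => ?_
    change evalAt p (2 * algebraMap ℝ _ (1 / 2)) = evalAt p 1
    rw [map_mul, map_ofNat, evalAt_algebraMap, map_one]
    norm_num

/-- The common source of all the operator claims; the applications differ only in the choice of c
and λ. -/
theorem isHamiltonian_of_pencil (hU₀ : ∀ u ∈ U, u 0 ≠ 0) (γ : ℝ) (c : Fin 3 → ℝ)
    {A : MatDiffOp 2} (lam : ℝ)
    {T : (Fin 2 → DiffAlg U) → Fin 2 → DiffAlg U}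
    {L : (Fin 2 → DiffAlg U) → (Fin 2 → DiffAlg U) → Fin 2 → DiffAlg U} (h : MatSem A T L)
    (hT : ∀ x i, T x i = pT D (pencil hU₀ γ c).b x i + algebraMap ℝ _ lam
      * rT D ((pencil hU₀ γ c).v * (pencil hU₀ γ c).i) (pencil hU₀ γ c).i x i)
    (hL : ∀ φ x i, L φ x i = pT D (fun i j => ev φ ((pencil hU₀ γ c).b i j)) x i
      + algebraMap ℝ _ lam
        * D (rV D ((pencil hU₀ γ c).v * (pencil hU₀ γ c).i) (pencil hU₀ γ c).i
          (ev φ ((pencil hU₀ γ c).v * (pencil hU₀ γ c).i)) (ev φ (pencil hU₀ γ c).i) x i)) :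
    IsHamiltonian (U : Set (Fin 2 → ℝ)) A :=
  h.isHamiltonian ((pencil hU₀ γ c).skew (D.map_algebraMap lam) hT)
    ((pencil hU₀ γ c).jacobi (D.map_algebraMap lam) ev (fun φ => ev_coord φ 0 0)
      (fun φ => ev_coord φ 0 1) (fun φ => (ev φ).map_algebraMap _)
      (fun φ => (ev φ).map_algebraMap _) (fun φ => (ev φ).map_algebraMap _)
      (fun φ => (ev φ).map_algebraMap _) hT hL)

theorem isHamiltonian_firstOrder (hU₀ : ∀ u ∈ U, u 0 ≠ 0) (γ : ℝ) (a : Fin 3)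
    (ha : Nondegenerate (U : Set (Fin 2 → ℝ)) (metric γ a)) :
    IsHamiltonian (U : Set (Fin 2 → ℝ)) (firstOrderOp (metric γ a)) :=
  isHamiltonian_of_pencil hU₀ γ (coeffs a) 0 (matSem_firstOrder hU₀ γ a ha)
    (fun x i => by simp) (fun φ x i => by simp)

theorem pT_add_smul (r : ℝ) (b b' : Fin 2 → Fin 2 → DiffAlg U) (x : Fin 2 → DiffAlg U)
    (i : Fin 2) :
    pT D b x i + r • pT D b' x i = pT D (fun i j => b i j + r • b' i j) x i := by
  simp only [pT, Fin.sum_univ_two, add_mul, map_add, smul_mul_assoc, Derivation.map_smul,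
    smul_add]
  abel

/-- Potentials are linear in c, so a combination of two first-order operators stays in the same
family and needs no new Jacobi computation. -/
theorem pencil_b_add_smul (hU₀ : ∀ u ∈ U, u 0 ≠ 0) (γ : ℝ) (c : Fin 3 → ℝ)
    (r : ℝ) (c' : Fin 3 → ℝ) (i j : Fin 2) :
    (pencil hU₀ γ c).b i j + r • (pencil hU₀ γ c').b i j
      = (pencil hU₀ γ (c + r • c')).b i j := by
  fin_cases i <;> fin_cases j <;>
    simp [Pencil.b, pencil, Pencil.w, Algebra.smul_def] <;> ring

theorem isHamiltonian_firstOrder_add (hU₀ : ∀ u ∈ U, u 0 ≠ 0) (γ : ℝ) (a a' : Fin 3)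
    (ha : Nondegenerate (U : Set (Fin 2 → ℝ)) (metric γ a))
    (ha' : Nondegenerate (U : Set (Fin 2 → ℝ)) (metric γ a')) (r : ℝ) :
    IsHamiltonian (U : Set (Fin 2 → ℝ))
      (firstOrderOp (metric γ a) + r • firstOrderOp (metric γ a')) := by
  refine isHamiltonian_of_pencil hU₀ γ (coeffs a + r • coeffs a') 0
    ((matSem_firstOrder hU₀ γ a ha).add_smul (matSem_firstOrder hU₀ γ a' ha') r)
    (fun x i => ?_) (fun φ x i => ?_)
  · simp only [pT_add_smul, pencil_b_add_smul, map_zero, zero_mul, add_zero]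
  · simp only [pT_add_smul, ← Derivation.map_smul, ← map_add, pencil_b_add_smul, map_zero,
      zero_mul, add_zero]

theorem isHamiltonian_firstOrder_add_thirdOrder (hU₀ : ∀ u ∈ U, u 0 ≠ 0) (γ : ℝ) (a : Fin 3)
    (ha : Nondegenerate (U : Set (Fin 2 → ℝ)) (metric γ a)) (r : ℝ) :
    IsHamiltonian (U : Set (Fin 2 → ℝ)) (firstOrderOp (metric γ a) + r • thirdOrderOp) :=
  isHamiltonian_of_pencil hU₀ γ (coeffs a) r
    ((matSem_firstOrder hU₀ γ a ha).add_smul (matSem_thirdOrder hU₀ γ (coeffs a)) r)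
    (fun x i => by rw [Algebra.smul_def]) (fun φ x i => by rw [Algebra.smul_def])

theorem isHamiltonian_thirdOrder (hU₀ : ∀ u ∈ U, u 0 ≠ 0) :
    IsHamiltonian (U : Set (Fin 2 → ℝ)) thirdOrderOp :=
  -- With c = 0 the potentials vanish and only R remains; the value of γ is then immaterial.
  isHamiltonian_of_pencil hU₀ 0 0 1 (matSem_thirdOrder hU₀ 0 0)
    (fun x i => by simp [pT, Pencil.b, pencil, Fin.sum_univ_two]; fin_cases i <;> simp)
    (fun φ x i => by simp [pT, Pencil.b, pencil, Fin.sum_univ_two]; fin_cases i <;> simp)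

end Instances

/-! ### Hamiltonian densities for the system -/

section Systems

variable {U : Opens (Fin 2 → ℝ)}

theorem repr_conservative (hU₀ : ∀ u ∈ U, u 0 ≠ 0) (γ : ℝ) (c : Fin 3 → ℝ) (i : Fin 2) :
    Repr (conservative (flux γ) i)
      (D ((![(pencil hU₀ γ c).v, (pencil hU₀ γ c).w] : Fin 2 → DiffAlg U) i)) := by
  refine Repr.totalD ?_
  fin_cases i
  · exact repr_coord 0 1
  · exact repr_w hU₀ γ c

theorem isHamiltonianSystem_firstOrder (hU₀ : ∀ u ∈ U, u 0 ≠ 0) (γ : ℝ) (a : Fin 3)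
    (ha : Nondegenerate (U : Set (Fin 2 → ℝ)) (metric γ a)) {f : (Fin 2 → ℝ) → ℝ}
    {k : DiffAlg U} (hf : Repr (ofField f) k) {x : Fin 2 → DiffAlg U}
    (hx : ∀ i, Repr (ofField (fieldPartial i f)) (x i))
    (h : ∀ i, D ((![(pencil hU₀ γ (coeffs a)).v, (pencil hU₀ γ (coeffs a)).w] :
      Fin 2 → DiffAlg U) i) = pT D (pencil hU₀ γ (coeffs a)).b x i) :
    IsHamiltonianSystem (U : Set (Fin 2 → ℝ)) (conservative (flux γ))
      (firstOrderOp (metric γ a)) := by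
  refine ⟨isHamiltonian_firstOrder hU₀ γ a ha, ofField f, hf.isDiffFun, fun i y J hJ => ?_⟩
  have hv : ∀ i, Repr (varDeriv (ofField f) i) (x i) := fun i => by
    rw [varDeriv_ofField]
    exact hx i
  rw [repr_conservative hU₀ γ (coeffs a) i y J hJ, h i]
  exact ((matSem_firstOrder hU₀ γ a ha).repr_apply hv i y J hJ).symm

theorem isHamiltonianSystem_zero (hU₀ : ∀ u ∈ U, u 0 ≠ 0) (γ : ℝ)
    (ha : Nondegenerate (U : Set (Fin 2 → ℝ)) (metric γ 0)) :
    IsHamiltonianSystem (U : Set (Fin 2 → ℝ)) (conservative (flux γ))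
      (firstOrderOp (metric γ 0)) := by
  -- The covector (0, 2) is constant, so P sends it to twice D of the second column of b, which is
  -- half the flux vector.
  refine isHamiltonianSystem_firstOrder hU₀ γ 0 ha (f := fun u => 2 * u 1)
    (k := algebraMap ℝ _ 2 * coord U 0 1) ?_ (x := ![0, algebraMap ℝ _ 2]) ?_ fun i => ?_
  · exact (repr_const 2).mul (repr_coord 0 1)
  · intro i
    refine repr_iff.2 fun x J h => ?_
    refine (fieldPartial_eq ((hasDerivAt_update (J 0) i 1).const_mul 2)).trans ?_
    fin_cases i <;> simp [evalAt_algebraMap]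
  · let P := pencil hU₀ γ (coeffs 0)
    have h : algebraMap ℝ (DiffAlg U) 2 * P.c₁ = 1 := by
      change algebraMap ℝ (DiffAlg U) 2 * algebraMap ℝ _ (1 / 2) = 1
      rw [← map_mul]
      norm_num
    have hd : (D : Derivation ℝ (DiffAlg U) (DiffAlg U)) (algebraMap ℝ _ 2) = 0 :=
      D.map_algebraMap _
    have hc₂ : P.c₂ = 0 := map_zero _
    have hc₃ : P.c₃ = 0 := map_zero _
    change D ((![P.v, P.w] : Fin 2 → DiffAlg U) i) = pT D P.b _ i
    fin_cases i
    · simp [pT, Pencil.b, hc₂, hc₃, hd, P.der_c₁]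
      linear_combination -D P.v * h
    · simp [pT, Pencil.b, hc₂, hc₃, hd, P.der_c₁]
      linear_combination -D P.w * h

theorem isHamiltonianSystem_one (hU₀ : ∀ u ∈ U, u 0 ≠ 0) (γ : ℝ)
    (ha : Nondegenerate (U : Set (Fin 2 → ℝ)) (metric γ 1)) :
    IsHamiltonianSystem (U : Set (Fin 2 → ℝ)) (conservative (flux γ))
      (firstOrderOp (metric γ 1)) := by
  let P := pencil hU₀ γ (coeffs 1)
  -- The first equation is D(u¹ x₂) = D u², solved by x₂ = (u² + γ/2)/u¹. The second then fixes the
  -- constant in x₁ = -((u² + γ/2)² + 1 + γ²/4)/(2(u¹)²), and these are the partial derivatives of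
  -- the stated density.
  refine isHamiltonianSystem_firstOrder hU₀ γ 1 ha
    (f := fun u => 1 / 2 * flux γ 1 u + (1 + γ ^ 2 / 4) * (u 0)⁻¹)
    (k := algebraMap ℝ _ (1 / 2) * P.w + algebraMap ℝ _ (1 + γ ^ 2 / 4) * P.i) ?_
    (x := ![-(algebraMap ℝ _ (1 / 2) * ((P.v + P.g) ^ 2 + 1 + P.g ^ 2) * P.i ^ 2),
      (P.v + P.g) * P.i]) ?_ fun i => ?_
  · exact ((repr_const _).mul (repr_w hU₀ γ _)).add ((repr_const _).mul (repr_invCoord hU₀))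
  · intro i
    refine repr_iff.2 fun x J h => ?_
    have hu : J 0 0 ≠ 0 := hU₀ _ h
    have e := hasDerivAt_update (J 0) i 0
    refine (fieldPartial_eq (((hasDerivAt_flux γ hu i).const_mul (1 / 2)).add
      ((e.inv (by simpa using hu)).const_mul (1 + γ ^ 2 / 4)))).trans ?_
    fin_cases i <;>
      simp [P, pencil, evalAt_algebraMap, evalAt_coord, evalAt_invCoord, flux] <;>
      (field_simp; try ring)
  · have h : (2 : DiffAlg U) * algebraMap ℝ _ (2⁻¹) = 1 := by
      rw [← map_ofNat (algebraMap ℝ (DiffAlg U)) 2, ← map_mul]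
      norm_num
    have hd : (D : Derivation ℝ (DiffAlg U) (DiffAlg U)) (algebraMap ℝ _ (2⁻¹)) = 0 :=
      D.map_algebraMap _
    have hc₁ : P.c₁ = 0 := map_zero _
    have hc₂ : P.c₂ = 1 := map_one _
    have hc₃ : P.c₃ = 0 := map_zero _
    change D ((![P.v, P.w] : Fin 2 → DiffAlg U) i) = pT D P.b _ i
    fin_cases i
    · simp [pT, Pencil.b, hc₁, hc₂, hc₃, P.der_g, P.der_i D]
      linear_combination ((P.v + P.g) * P.i * D P.u - D P.v) * P.u_mul_i
    · simp [pT, Pencil.b, hc₁, hc₂, hc₃, P.der_g, P.der_i D, hd, Pencil.w, derivation_two,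
        Derivation.leibniz_pow]
      linear_combination ((P.v + P.g) * D P.v * P.i
        - ((P.v + P.g) ^ 2 + 1 + P.g ^ 2) * P.i ^ 2 * D P.u) * P.u_mul_i
        + ((P.v + P.g) * D P.v * P.u * P.i ^ 2
        - ((P.v + P.g) ^ 2 + 1 + P.g ^ 2) * P.u * P.i ^ 3 * D P.u) * h

theorem isHamiltonianSystem_two (hU₀ : ∀ u ∈ U, u 0 ≠ 0) (γ : ℝ)
    (ha : Nondegenerate (U : Set (Fin 2 → ℝ)) (metric γ 2)) :
    IsHamiltonianSystem (U : Set (Fin 2 → ℝ)) (conservative (flux γ))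
      (firstOrderOp (metric γ 2)) := by
  -- P sends the constant covector (1, 0) to D of the first column of b, which is the flux vector up
  -- to the additive constant γ/2.
  refine isHamiltonianSystem_firstOrder hU₀ γ 2 ha (f := fun u => u 0) (repr_coord 0 0)
    (x := ![1, 0]) ?_ fun i => ?_
  · intro i
    refine repr_iff.2 fun x J h => ?_
    refine (fieldPartial_eq (hasDerivAt_update (J 0) i 0)).trans ?_
    fin_cases i <;> simp
  · have hg := (pencil hU₀ γ (coeffs 2)).der_g
    fin_cases i <;> simp_all [pT, Pencil.b, pencil, coeffs, Pencil.w]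

end Systems

end HydroJet

end

theorem mainTheorem6 (γ : ℝ) (U : Set (Fin 2 → ℝ)) (hU : IsOpen U)
    (hU0 : ∀ u ∈ U, u 0 ≠ 0) :
    (∀ i : Fin 3, HydroJet.Nondegenerate U (HydroJet.metric γ i) →
      HydroJet.IsHamiltonianSystem U (HydroJet.conservative (HydroJet.flux γ))
        (HydroJet.firstOrderOp (HydroJet.metric γ i)) ∧
      HydroJet.Compatible U (HydroJet.firstOrderOp (HydroJet.metric γ i))
        HydroJet.thirdOrderOp) ∧
    (∀ i j : Fin 3, HydroJet.Nondegenerate U (HydroJet.metric γ i) →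
      HydroJet.Nondegenerate U (HydroJet.metric γ j) →
      HydroJet.Compatible U (HydroJet.firstOrderOp (HydroJet.metric γ i))
        (HydroJet.firstOrderOp (HydroJet.metric γ j))) := by
  have h₀ : ∀ u ∈ (⟨U, hU⟩ : TopologicalSpace.Opens (Fin 2 → ℝ)), u 0 ≠ 0 := hU0
  refine ⟨fun i hi => ⟨?_, HydroJet.isHamiltonian_firstOrder h₀ γ i hi,
    HydroJet.isHamiltonian_thirdOrder h₀,
    HydroJet.isHamiltonian_firstOrder_add_thirdOrder h₀ γ i hi⟩, fun i j hi hj =>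
    ⟨HydroJet.isHamiltonian_firstOrder h₀ γ i hi, HydroJet.isHamiltonian_firstOrder h₀ γ j hj,
    HydroJet.isHamiltonian_firstOrder_add h₀ γ i j hi hj⟩⟩
  fin_cases i
  · exact HydroJet.isHamiltonianSystem_zero h₀ γ hi
  · exact HydroJet.isHamiltonianSystem_one h₀ γ hi
  · exact HydroJet.isHamiltonianSystem_two h₀ γ hi
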